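/- Let $v_1,v_2,v_3\in\mathbb R^2$ be distinct and non-collinear, let $\Delta=\mathrm{co}\{v_1,v_2,v_3\}$, let $q$ be the circumcenter of $\Delta$ (so $|v_1-q|=|v_2-q|=|v_3-q|$), and let $\varphi(y)=\min_{i=1,2,3}v_i\cdot y$. For $\varepsilon>0$ let $$u^\varepsilon_t(x)=-\varepsilon\log\Big(\frac1{2\pi\varepsilon t}\int_{\mathbb R^2}\exp\Big(-\frac{|x-y|^2}{2\varepsilon t}-\frac{\varphi(y)}{\varepsilon}\Big)\,dy\Big)\qquad(t>0)$$ be the Cole–Hopf solution of $\partial_tu^\varepsilon+\frac12|\nabla u^\varepsilon|^2=\frac\varepsilon2\nabla\cdot\nabla u^\varepsilon$, $u^\varepsilon_0=\varphi$. Let $t\mapsto X^\varepsilon_t(y)$ be the continuous path on $[0,\infty)$ with $X^\varepsilon_0(y)=y$ and $\partial_tX^\varepsilon_t(y)=\nabla u^\varepsilon_t(X^\varepsilon_t(y))$ for $t>0$. Let $X_t(y)=\lim_{\varepsilon\to0^+}X^\varepsilon_t(y)$ be the adhesion-model Lagrangian flow, and let $\rho_t=(X_t)_\sharp\lambda$ be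 the push-forward of Lebesgue measure $\lambda$ under $X_t$. Assume $q\notin\Delta$ and let $t>0$. Let $\tilde T_t$ be a measurable $\mathbb R^2$-valued map, with domain of definition $D\subset\mathbb R^2$, that is defined a.e. in an open set $\Omega$ containing the closed triangle $t(q-\Delta)=\{t(q-p):p\in\Delta\}$. Suppose that for some neighborhood $N$ of the point $tq$: 1. $(\tilde T_t)_\sharp(\lambda|_D)(B)=\rho_t(B)$ for every Borel set $B\subset N$; 2. $\tilde T_t^{-1}(x)=X_t^{-1}(x)$, as sets, for a.e. $x\in N$. Then $\tilde T_t$ is not monotone in any neighborhood of the triangle $t(q-\Delta)$: for every neighborhood $U$ of $t(q-\Delta)$ there are $y,\hat y\in U\cap D$ with $(\tilde T_t(y)-\tilde T_t(\hat y))\cdot(y-\hat y)<0$. Also, $\tilde T_t$ is not the gradient of a convex function there: for no neighborhood $U$ of $t(q-\Delta)$ is there a convex function $\psi$ on $U$ with $\nabla\psi(y)=\tilde T_t(y)$ for a.e. $y\in U\cap D$. -/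

import Mathlib

open MeasureTheory Filter Topology

noncomputable section

/-- The Euclidean plane, with its Euclidean norm, inner product and Lebesgue measure `volume`. -/
abbrev Plane : Type := EuclideanSpace ℝ (Fin 2)

/-- The three-sector velocity potential `φ(y) = min_i v_i · y`, where the `v_i` are the vertices
of the (nondegenerate) triangle `Δ`. -/
def threeSectorPotential (Δ : Affine.Triangle ℝ Plane) (y : Plane) : ℝ :=
  Finset.univ.inf' Finset.univ_nonempty fun i : Fin 3 => inner ℝ (Δ.points i) y

/-- The solution `u^ε_t(x)` of the potential Burgers equation
`∂_t u + |∇u|² / 2 = (ε/2) Laplacian u`, `u(·, 0) = φ`, in the plane,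
given by the Cole-Hopf formula
`u^ε_t(x) = -ε log ((2πεt)⁻¹ ∫ exp (-|x - y|² / (2εt) - φ(y) / ε) dy)`. -/
def burgersPotential (φ : Plane → ℝ) (ε t : ℝ) (x : Plane) : ℝ :=
  -ε * Real.log ((2 * Real.pi * ε * t)⁻¹ *
    ∫ y : Plane, Real.exp (-‖x - y‖ ^ 2 / (2 * ε * t) - φ y / ε))

/-- The viscous velocity `v^ε_t = ∇ u^ε_t`. -/
def burgersVelocity (φ : Plane → ℝ) (ε t : ℝ) (x : Plane) : Plane :=
  gradient (burgersPotential φ ε t) x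

/-- `z` is a path of the viscous velocity field started at `y`: `z(0) = y`, `z` is continuous
on `[0, ∞)`, and `z'(t) = v^ε(z(t), t)` for all `t > 0`. -/
def IsViscousPath (φ : Plane → ℝ) (ε : ℝ) (y : Plane) (z : ℝ → Plane) : Prop :=
  z 0 = y ∧ ContinuousOn z (Set.Ici 0) ∧
    ∀ t : ℝ, 0 < t → HasDerivAt z (burgersVelocity φ ε t (z t)) t

/-- The viscous Lagrangian flow map `X^ε_t(y)`: the position at time `t ≥ 0` of the path of the
velocity field `v^ε` started at `y`. -/
def viscousFlow (φ : Plane → ℝ) (ε t : ℝ) (y : Plane) : Plane :=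
  Classical.epsilon (IsViscousPath φ ε y) t

/-- The Lagrangian flow map of the adhesion model, `X_t(y) = lim_{ε → 0⁺} X^ε_t(y)`. -/
def adhesionFlow (φ : Plane → ℝ) (t : ℝ) (y : Plane) : Plane :=
  limUnder (𝓝[>] (0 : ℝ)) fun ε => viscousFlow φ ε t y

/-- The mass measure `ρ_t`, the push-forward of Lebesgue measure under `X_t`. -/
def adhesionMass (φ : Plane → ℝ) (t : ℝ) : Measure Plane :=
  Measure.map (adhesionFlow φ t) volume

/-- The closed triangle `t (q - Δ)`, where `q` is the circumcenter of `Δ`. -/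
def backTriangle (Δ : Affine.Triangle ℝ Plane) (t : ℝ) : Set Plane :=
  (fun p => t • (Δ.circumcenter - p)) '' convexHull ℝ (Set.range Δ.points)

/-- The map `T`, with domain of definition `D`, is monotone on `U`. -/
def IsMonotoneMapOn (D : Set Plane) (T : Plane → Plane) (U : Set Plane) : Prop :=
  ∀ y ∈ U ∩ D, ∀ y' ∈ U ∩ D, 0 ≤ inner ℝ (T y - T y') (y - y')

/-- The map `T`, with domain of definition `D`, is almost everywhere on `U` the gradient of a
convex function on `U`. -/
def IsConvexGradientOn (D : Set Plane) (T : Plane → Plane) (U : Set Plane) : Prop :=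
  ∃ ψ : Plane → ℝ, ConvexOn ℝ U ψ ∧ ∀ᵐ y, y ∈ U → y ∈ D → HasGradientAt ψ (T y) y

end

/-!
Since `φ` is concave and Lipschitz, log-concavity of Gaussian mixtures makes every `u^ε_t` concave,
with the Lipschitz constant of `φ`. Hence the viscous velocity field is bounded and dissipative, its
paths exist from time `0`, and its flow contracts distances.

For `φ(y) = min_i v_i · y` with `n` velocities, comparing with linear data, whose Cole–Hopf
solutions are explicit, shows that `u^ε_t` lies within `ε log n` of
`w_t(x) = min_i (v_i · x - t |v_i|² / 2)`. The velocity is thus an approximate supergradient of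
`w_t`: `∇u^ε_t(x) · (x - y) ≤ w_t(x) - w_t(y) + ε log n`. Comparing two such paths by an energy
estimate gives the convergence of `X^ε_t` as `ε → 0⁺`, and comparing a path with a straight line
shows that particles which end in the sector of `v_i` have moved freely with velocity `v_i`.

As `q ∉ co {v_i}`, there are `h` and `c` with `q · h < c ≤ v_i · h` for all `i`, so every particle
advances in the direction `h` at a rate of at least `c`. By the scaling `X_{λt}(λy) = λ X_t(y)`, no
ray from the origin contains two particles that are at `tq` at time `t`; these particles therefore
form a null set. On the other hand, a monotone `T` that agrees with the free motion in all the
sectors meeting at `tq` has `(T y - tq) · (y - t(q - v_i)) ≥ 0` for every `i`, which forces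
`T y = tq` for `y` in the interior of `t(q - Δ)`: a set of positive measure is mapped to `tq`,
contradicting the push-forward property.
-/

section

open Set

section ConvexAnalysis

variable {E : Type*} [NormedAddCommGroup E] [InnerProductSpace ℝ E]

theorem add_inner_le_of_convexOn_of_hasGradientAt [CompleteSpace E] {s : Set E} {f : E → ℝ}
    (hf : ConvexOn ℝ s f) {a b g : E} (ha : a ∈ s) (hb : b ∈ s) (hg : HasGradientAt f g a) :
    f a + inner ℝ g (b - a) ≤ f b := by
  have hline : HasDerivAt (f ∘ AffineMap.lineMap a b) (inner ℝ g (b - a)) (0 : ℝ) := by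
    rw [← InnerProductSpace.toDual_apply_apply]
    refine HasFDerivAt.comp_hasDerivAt (0 : ℝ) ?_ AffineMap.hasDerivAt_lineMap
    simpa using hg.hasFDerivAt
  have hslope := (hf.comp_affineMap (AffineMap.lineMap a b)).le_slope_of_hasDerivAt
    (x := (0 : ℝ)) (y := 1) (by simpa) (by simpa) one_pos hline
  simp only [slope_def_field, Function.comp_apply, AffineMap.lineMap_apply_zero,
    AffineMap.lineMap_apply_one, sub_zero, div_one] at hslope
  linarith

theorem inner_sub_nonneg_of_convexOn_of_hasGradientAt [CompleteSpace E] {s : Set E} {f : E → ℝ}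
    (hf : ConvexOn ℝ s f) {a b g h : E} (ha : a ∈ s) (hb : b ∈ s) (hg : HasGradientAt f g a)
    (hh : HasGradientAt f h b) : 0 ≤ inner ℝ (g - h) (a - b) := by
  have hab := add_inner_le_of_convexOn_of_hasGradientAt hf ha hb hg
  have hba := add_inner_le_of_convexOn_of_hasGradientAt hf hb ha hh
  rw [← neg_sub a b, inner_neg_right] at hab
  rw [inner_sub_left]
  linarith

theorem eq_zero_of_forall_inner_nonneg {s : Set E} {p w : E} (hp : p ∈ interior s)
    (h : ∀ x ∈ s, 0 ≤ inner ℝ w (x - p)) : w = 0 := by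
  have hcont : Continuous fun r : ℝ => p - r • w := by fun_prop
  have hmem : ∀ᶠ r : ℝ in 𝓝[>] 0, p - r • w ∈ s :=
    nhdsWithin_le_nhds <| hcont.tendsto' 0 p (by simp) (mem_interior_iff_mem_nhds.1 hp)
  obtain ⟨r, hr, hrpos⟩ := (hmem.and self_mem_nhdsWithin).exists
  have hrw := h _ hr
  rw [sub_sub_cancel_left, inner_neg_right, inner_smul_right, real_inner_self_eq_norm_sq] at hrw
  have hsq : ‖w‖ ^ 2 ≤ 0 := nonpos_of_mul_nonpos_right (by linarith) (show 0 < r from hrpos)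
  simpa using hsq.antisymm (sq_nonneg _)

end ConvexAnalysis

section ParameterIntegrals

theorem convexOn_log_integral_exp {V α : Type*} [AddCommGroup V] [Module ℝ V]
    [MeasurableSpace α] {μ : Measure α} [NeZero μ] {s : Set V} {h : V → α → ℝ}
    (hconv : ∀ z, ConvexOn ℝ s fun x => h x z)
    (hint : ∀ x ∈ s, Integrable (fun z => Real.exp (h x z)) μ) :
    ConvexOn ℝ s fun x => Real.log (∫ z, Real.exp (h x z) ∂μ) := by
  obtain ⟨z₀⟩ : Nonempty α := Measure.nonempty_of_neZero μ
  have hpos : ∀ x ∈ s, 0 < ∫ z, Real.exp (h x z) ∂μ := fun x hx =>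
    MeasureTheory.integral_exp_pos (hint x hx)
  refine ⟨(hconv z₀).1, fun a ha b hb p q hp hq hpq => ?_⟩
  have hm := (hconv z₀).1 ha hb hp hq hpq
  set A := ∫ z, Real.exp (h a z) ∂μ
  set B := ∫ z, Real.exp (h b z) ∂μ
  set c := p * Real.log A + q * Real.log B
  have hpointwise : ∀ z, Real.exp (h (p • a + q • b) z - c) ≤
      p * (Real.exp (h a z) / A) + q * (Real.exp (h b z) / B) := fun z => by
    have hle : h (p • a + q • b) z - c ≤
        p • (h a z - Real.log A) + q • (h b z - Real.log B) := by
      have := (hconv z).2 ha hb hp hq hpq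
      simp only [smul_eq_mul, c] at this ⊢
      linarith
    refine (Real.exp_le_exp.2 hle).trans ?_
    have := convexOn_exp.2 (mem_univ (h a z - Real.log A)) (mem_univ (h b z - Real.log B)) hp hq hpq
    rwa [Real.exp_sub, Real.exp_sub, Real.exp_log (hpos a ha), Real.exp_log (hpos b hb)] at this
  have hA := ((hint a ha).div_const A).const_mul p
  have hB := ((hint b hb).div_const B).const_mul q
  have hmain := integral_mono_of_nonneg (Eventually.of_forall fun _ => (Real.exp_pos _).le)
    (hA.add hB) (Eventually.of_forall hpointwise)
  simp only [Pi.add_apply] at hmain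
  rw [integral_add hA hB, integral_const_mul, integral_const_mul, integral_div, integral_div,
    div_self (hpos a ha).ne', div_self (hpos b hb).ne', mul_one, mul_one, hpq] at hmain
  simp_rw [Real.exp_sub] at hmain
  rw [integral_div, div_le_one (Real.exp_pos _)] at hmain
  exact (Real.log_le_iff_le_exp (hpos _ hm)).2 hmain

theorem hasGradientAt_integral_of_dominated {α E : Type*} [MeasurableSpace α] {μ : Measure α}
    [NormedAddCommGroup E] [InnerProductSpace ℝ E] [CompleteSpace E] {f : E → α → ℝ}
    {f' : E → α → E} {s : Set E} {x : E} {bound : α → ℝ} (hs : s ∈ 𝓝 x)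
    (hf : ∀ x ∈ s, Integrable (f x) μ) (hf' : AEStronglyMeasurable (f' x) μ)
    (hle : ∀ x ∈ s, ∀ z, ‖f' x z‖ ≤ bound z) (hbound : Integrable bound μ)
    (hgrad : ∀ x ∈ s, ∀ z, HasGradientAt (fun x => f x z) (f' x z) x) :
    HasGradientAt (fun x => ∫ z, f x z ∂μ) (∫ z, f' x z ∂μ) x := by
  let L := (InnerProductSpace.toDual ℝ E).toContinuousLinearEquiv
  have hint : Integrable (f' x) μ :=
    hbound.mono' hf' (Eventually.of_forall (hle x (mem_of_mem_nhds hs)))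
  have h := hasFDerivAt_integral_of_dominated_of_fderiv_le (F' := fun x z => L (f' x z)) hs
    (by filter_upwards [hs] with y hy using (hf y hy).1) (hf x (mem_of_mem_nhds hs))
    (L.continuous.comp_aestronglyMeasurable hf')
    (Eventually.of_forall fun z y hy => by simpa [L] using hle y hy z) hbound
    (Eventually.of_forall fun z y hy => (hgrad y hy z).hasFDerivAt)
  rwa [← L.coe_coe, ContinuousLinearMap.integral_comp_commSL (by simp) _ hint] at h

theorem abs_div_sub_div_le_of_le_exp_mul {k k' m m' s : ℝ} (hk : 0 ≤ k) (hm : 0 < m)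
    (hle : k ≤ Real.exp s * k') (hle' : k' ≤ Real.exp s * k) (hm₁ : m ≤ Real.exp s * m')
    (hm₂ : m' ≤ Real.exp s * m) : |k' / m' - k / m| ≤ (Real.exp (2 * s) - 1) * (k / m) := by
  have hm' : 0 < m' := pos_of_mul_pos_right (hm.trans_le hm₁) (Real.exp_pos s).le
  have hexp : Real.exp (2 * s) = Real.exp s * Real.exp s := by rw [two_mul, Real.exp_add]
  have hupper : k' / m' ≤ Real.exp (2 * s) * (k / m) := by
    rw [← mul_div_assoc, div_le_div_iff₀ hm' hm, hexp]
    calc k' * m ≤ (Real.exp s * k) * (Real.exp s * m') :=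
          mul_le_mul hle' hm₁ hm.le (mul_nonneg (Real.exp_pos s).le hk)
      _ = _ := by ring
  have hlower : k / m ≤ Real.exp (2 * s) * (k' / m') := by
    rw [← mul_div_assoc, div_le_div_iff₀ hm hm', hexp]
    calc k * m' ≤ (Real.exp s * k') * (Real.exp s * m) :=
          mul_le_mul hle hm₂ hm'.le (hk.trans hle)
      _ = _ := by ring
  rw [← inv_mul_le_iff₀ (Real.exp_pos _), ← Real.exp_neg] at hlower
  have hcosh : 1 - Real.exp (-(2 * s)) ≤ Real.exp (2 * s) - 1 := by
    linarith [Real.add_one_le_exp (2 * s), Real.add_one_le_exp (-(2 * s))]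
  have := mul_le_mul_of_nonneg_right hcosh (div_nonneg hk hm.le)
  rw [abs_sub_le_iff]
  exact ⟨by linarith, by linarith⟩

theorem norm_average_sub_average_le {α E : Type*} [MeasurableSpace α] {μ : Measure α}
    [NormedAddCommGroup E] [NormedSpace ℝ E] {k k' : α → ℝ} {g : α → E} {s : ℝ}
    (hk : Integrable k μ) (hk' : Integrable k' μ) (hg : Integrable (fun z => k z • g z) μ)
    (hg' : Integrable (fun z => k' z • g z) μ) (hpos : 0 < ∫ z, k z ∂μ) (hk0 : ∀ z, 0 ≤ k z)
    (hle : ∀ z, k z ≤ Real.exp s * k' z) (hle' : ∀ z, k' z ≤ Real.exp s * k z) :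
    ‖(∫ z, k' z ∂μ)⁻¹ • ∫ z, k' z • g z ∂μ - (∫ z, k z ∂μ)⁻¹ • ∫ z, k z • g z ∂μ‖ ≤
      (Real.exp (2 * s) - 1) * ((∫ z, k z * ‖g z‖ ∂μ) / ∫ z, k z ∂μ) := by
  have hm : ∫ z, k z ∂μ ≤ Real.exp s * ∫ z, k' z ∂μ :=
    (integral_mono hk (hk'.const_mul _) hle).trans_eq (integral_const_mul _ _)
  have hm' : ∫ z, k' z ∂μ ≤ Real.exp s * ∫ z, k z ∂μ :=
    (integral_mono hk' (hk.const_mul _) hle').trans_eq (integral_const_mul _ _)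
  set m := ∫ z, k z ∂μ
  set m' := ∫ z, k' z ∂μ
  have hmom := (hg.norm.div_const m).const_mul (Real.exp (2 * s) - 1)
  simp only [norm_smul, Real.norm_of_nonneg (hk0 _)] at hmom
  have hpointwise : ∀ z, ‖m'⁻¹ • k' z • g z - m⁻¹ • k z • g z‖ ≤
      (Real.exp (2 * s) - 1) * (k z * ‖g z‖ / m) := fun z => by
    rw [smul_smul, smul_smul, ← sub_smul, norm_smul, Real.norm_eq_abs, ← div_eq_inv_mul,
      ← div_eq_inv_mul, mul_div_right_comm, ← mul_assoc]
    gcongr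
    exact abs_div_sub_div_le_of_le_exp_mul (hk0 z) hpos (hle z) (hle' z) hm hm'
  calc _ = ‖∫ z, m'⁻¹ • k' z • g z - m⁻¹ • k z • g z ∂μ‖ := by
        rw [← integral_smul, ← integral_smul]
        exact congrArg norm (integral_sub (hg'.smul m'⁻¹) (hg.smul m⁻¹)).symm
    _ ≤ ∫ z, (Real.exp (2 * s) - 1) * (k z * ‖g z‖ / m) ∂μ :=
        norm_integral_le_of_norm_le hmom (Eventually.of_forall hpointwise)
    _ = _ := by rw [integral_const_mul, integral_div]

end ParameterIntegrals

section DissipativeFields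

/-- A time-dependent vector field on `t > 0` that is bounded by `M`, continuous in time, Lipschitz
in space locally uniformly in `(t, x)`, and dissipative, so that its integral curves contract
distances. Nothing is asked as `t → 0⁺` except the bound, which is what allows integral curves to
start at time `0`. -/
structure IsDissipativeField {E : Type*} [NormedAddCommGroup E] [InnerProductSpace ℝ E]
    (v : ℝ → E → E) (M : NNReal) : Prop where
  norm_le : ∀ ⦃t⦄, 0 < t → ∀ x, ‖v t x‖ ≤ M
  continuousAt : ∀ ⦃t⦄, 0 < t → ∀ x, ContinuousAt (fun s => v s x) t
  exists_lipschitzOnWith : ∀ ⦃δ⦄, 0 < δ → ∀ T R, ∃ K : NNReal, ∀ t ∈ Icc δ T,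
    LipschitzOnWith K (v t) (Metric.closedBall 0 R)
  inner_sub_nonpos : ∀ ⦃t⦄, 0 < t → ∀ x y, inner ℝ (v t x - v t y) (x - y) ≤ 0

variable {E : Type*} [NormedAddCommGroup E] [InnerProductSpace ℝ E]

theorem norm_sq_le_of_inner_deriv_le {a a' : ℝ → E} {s t η : ℝ} (hst : s ≤ t)
    (hc : ContinuousOn a (Icc s t)) (hd : ∀ r ∈ Ioo s t, HasDerivAt a (a' r) r)
    (h : ∀ r ∈ Ioo s t, inner ℝ (a' r) (a r) ≤ η) :
    ‖a t‖ ^ 2 ≤ ‖a s‖ ^ 2 + 2 * η * (t - s) := by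
  have hderiv : ∀ r ∈ interior (Icc s t),
      HasDerivAt (fun r => ‖a r‖ ^ 2) (2 * inner ℝ (a r) (a' r)) r := by
    rw [interior_Icc]
    exact fun r hr => (hd r hr).norm_sq
  have hgrowth := (convex_Icc s t).image_sub_le_mul_sub_of_deriv_le (f := fun r => ‖a r‖ ^ 2)
    (C := 2 * η) (hc.norm.pow 2)
    (fun r hr => (hderiv r hr).differentiableAt.differentiableWithinAt)
    (fun r hr => by
      rw [(hderiv r hr).deriv, real_inner_comm]
      rw [interior_Icc] at hr
      linarith [h r hr])
    s (left_mem_Icc.2 hst) t (right_mem_Icc.2 hst) hst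
  linarith

theorem norm_sq_sub_le_of_inner_sub_le {W : ℝ → E → ℝ} {z z' w w' : ℝ → E} {s t η η' : ℝ}
    (hst : s ≤ t) (hz : ContinuousOn z (Icc s t)) (hw : ContinuousOn w (Icc s t))
    (hzd : ∀ r ∈ Ioo s t, HasDerivAt z (z' r) r) (hwd : ∀ r ∈ Ioo s t, HasDerivAt w (w' r) r)
    (hzW : ∀ r ∈ Ioo s t, ∀ p, inner ℝ (z' r) (z r - p) ≤ W r (z r) - W r p + η)
    (hwW : ∀ r ∈ Ioo s t, ∀ p, inner ℝ (w' r) (w r - p) ≤ W r (w r) - W r p + η') :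
    ‖z t - w t‖ ^ 2 ≤ ‖z s - w s‖ ^ 2 + 2 * (η + η') * (t - s) := by
  refine norm_sq_le_of_inner_deriv_le (a := fun r => z r - w r) hst (hz.sub hw)
    (fun r hr => (hzd r hr).sub (hwd r hr)) fun r hr => ?_
  have hz_inner := hzW r hr (w r)
  have hw_inner := hwW r hr (z r)
  rw [← neg_sub, inner_neg_right] at hw_inner
  rw [inner_sub_left]
  linarith

namespace IsDissipativeField

variable {v : ℝ → E → E} {M : NNReal}

theorem norm_sub_le (hv : IsDissipativeField v M) {z w : ℝ → E} {s t : ℝ} (hs : 0 ≤ s)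
    (hst : s ≤ t) (hz : ContinuousOn z (Icc s t)) (hw : ContinuousOn w (Icc s t))
    (hz' : ∀ r ∈ Ioo s t, HasDerivAt z (v r (z r)) r)
    (hw' : ∀ r ∈ Ioo s t, HasDerivAt w (v r (w r)) r) : ‖z t - w t‖ ≤ ‖z s - w s‖ := by
  have h := norm_sq_le_of_inner_deriv_le (a := fun r => z r - w r) (η := 0) hst (hz.sub hw)
    (fun r hr => (hz' r hr).sub (hw' r hr))
    (fun r hr => hv.inner_sub_nonpos (hs.trans_lt hr.1) _ _)
  rw [mul_zero, zero_mul, add_zero] at h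
  exact le_of_sq_le_sq h (norm_nonneg _)

theorem norm_sub_le_of_isIntegralCurveOn (hv : IsDissipativeField v M) {z w : ℝ → E} {s t : ℝ}
    (hs : 0 ≤ s) (hst : s ≤ t) (hz : IsIntegralCurveOn z v (Icc s t))
    (hw : IsIntegralCurveOn w v (Icc s t)) : ‖z t - w t‖ ≤ ‖z s - w s‖ :=
  hv.norm_sub_le hs hst hz.continuousOn hw.continuousOn
    (fun r hr => (hz r (Ioo_subset_Icc_self hr)).hasDerivAt (Icc_mem_nhds hr.1 hr.2))
    (fun r hr => (hw r (Ioo_subset_Icc_self hr)).hasDerivAt (Icc_mem_nhds hr.1 hr.2))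

theorem norm_sub_start_le (hv : IsDissipativeField v M) {z : ℝ → E} {s t : ℝ} (hs : 0 < s)
    (hst : s ≤ t) (hz : IsIntegralCurveOn z v (Icc s t)) : ‖z t - z s‖ ≤ M * (t - s) :=
  norm_image_sub_le_of_norm_deriv_le_segment' hz
    (fun _ hr => hv.norm_le (hs.trans_le hr.1) _) t (right_mem_Icc.2 hst)

theorem exists_isIntegralCurveOn [CompleteSpace E] (hv : IsDissipativeField v M) {s t : ℝ}
    (hs : 0 < s) (hst : s ≤ t) (y : E) : ∃ z, z s = y ∧ IsIntegralCurveOn z v (Icc s t) := by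
  obtain ⟨K, hK⟩ := hv.exists_lipschitzOnWith hs t (‖y‖ + M * (t - s))
  have hball : Metric.closedBall y (M * (t - s)) ⊆ Metric.closedBall 0 (‖y‖ + M * (t - s)) :=
    Metric.closedBall_subset_closedBall' (by rw [dist_zero_right, add_comm])
  have hpicard : IsPicardLindelof v (tmin := s) (tmax := t) ⟨s, left_mem_Icc.2 hst⟩ y
      ⟨M * (t - s), mul_nonneg M.coe_nonneg (sub_nonneg.2 hst)⟩ 0 M K :=
    { lipschitzOnWith := fun r hr => (hK r hr).mono hball
      continuousOn := fun x _ r hr =>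
        (hv.continuousAt (hs.trans_le hr.1) x).continuousWithinAt
      norm_le := fun r hr x _ => hv.norm_le (hs.trans_le hr.1) x
      mul_max_le := by
        change (M : ℝ) * max (t - s) (s - s) ≤ M * (t - s) - (0 : NNReal)
        simp [hst] }
  exact hpicard.exists_eq_forall_mem_Icc_hasDerivWithinAt₀

theorem norm_sub_le_of_eq_start (hv : IsDissipativeField v M) {z w : ℝ → E} {s r t : ℝ}
    (hs : 0 < s) (hsr : s ≤ r) (hrt : r ≤ t) (hz : IsIntegralCurveOn z v (Icc s t))
    (hw : IsIntegralCurveOn w v (Icc r t)) (h : z s = w r) : ‖z t - w t‖ ≤ M * r := by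
  have hstart := hv.norm_sub_start_le hs hsr (hz.mono (Icc_subset_Icc_right hrt))
  have hcontract := hv.norm_sub_le_of_isIntegralCurveOn (hs.le.trans hsr) hrt
    (hz.mono (Icc_subset_Icc_left hsr)) hw
  rw [← h] at hcontract
  have := mul_nonneg M.coe_nonneg hs.le
  linarith

-- Curves released from `y` at times `δ → 0⁺` are a Cauchy family at time `t`: the earlier one has
-- moved by at most `M * δ` when the later one starts, and the flow contracts.
theorem exists_limit_of_start_zero [CompleteSpace E] (hv : IsDissipativeField v M) (y : E) {t : ℝ}
    (ht : 0 < t) : ∃ p, ∀ ⦃s⦄, 0 < s → s ≤ t → ∀ ⦃z⦄, z s = y →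
      IsIntegralCurveOn z v (Icc s t) → ‖z t - p‖ ≤ M * s := by
  set δ : ℕ → ℝ := fun n => t / (n + 1) with hδ
  have hδpos : ∀ n, 0 < δ n := fun n => by positivity
  have hδle : ∀ n, δ n ≤ t := fun n => div_le_self ht.le (by simp)
  have hδanti : Antitone δ := fun m n hmn => by
    have : (m : ℝ) ≤ n := Nat.cast_le.2 hmn
    simp only [hδ]
    gcongr
  have hδlim : Tendsto δ atTop (𝓝 0) :=
    tendsto_const_div_atTop_nhds_zero_nat t |>.comp (tendsto_add_atTop_nat 1) |>.congr
      (by simp [hδ])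
  choose γ hγ hγ' using fun n => hv.exists_isIntegralCurveOn (hδpos n) (hδle n) y
  have hcauchy : CauchySeq fun n => γ n t := by
    refine cauchySeq_of_le_tendsto_0' (fun n => M * δ n) (fun n m hnm => ?_)
      (by simpa using hδlim.const_mul (M : ℝ))
    rw [dist_comm, dist_eq_norm]
    exact hv.norm_sub_le_of_eq_start (hδpos m) (hδanti hnm) (hδle n) (hγ' m) (hγ' n)
      ((hγ m).trans (hγ n).symm)
  obtain ⟨p, hp⟩ := cauchySeq_tendsto_of_complete hcauchy
  refine ⟨p, fun s hs hst z hzs hz => ?_⟩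
  refine le_of_tendsto (tendsto_const_nhds.sub hp).norm ?_
  filter_upwards [hδlim.eventually (gt_mem_nhds hs)] with n hn
  rw [norm_sub_rev]
  exact hv.norm_sub_le_of_eq_start (hδpos n) hn.le hst (hγ' n) hz ((hγ n).trans hzs.symm)

theorem eq_of_forall_norm_sub_le [CompleteSpace E] (hv : IsDissipativeField v M) {y : E}
    {Z w : ℝ → E} (hZ : ∀ ⦃t⦄, 0 < t → ∀ ⦃s⦄, 0 < s → s ≤ t → ∀ ⦃z⦄, z s = y →
      IsIntegralCurveOn z v (Icc s t) → ‖z t - Z t‖ ≤ M * s)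
    {a b : ℝ} (ha : 0 < a) (hab : a ≤ b) (hw : IsIntegralCurveOn w v (Icc a b)) (hwa : w a = Z a) :
    w b = Z b := by
  have hle : ∀ s ∈ Ioc 0 a, ‖w b - Z b‖ ≤ 2 * (M * s) := by
    rintro s ⟨hs, hsa⟩
    obtain ⟨z, hzs, hz⟩ := hv.exists_isIntegralCurveOn hs (hsa.trans hab) y
    have hza := hZ ha hs hsa hzs (hz.mono (Icc_subset_Icc_right hab))
    have hzb := hZ (ha.trans_le hab) hs (hsa.trans hab) hzs hz
    have hzw := hv.norm_sub_le_of_isIntegralCurveOn ha.le hab (hz.mono (Icc_subset_Icc_left hsa)) hw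
    rw [hwa] at hzw
    have := norm_sub_le_norm_sub_add_norm_sub (w b) (z b) (Z b)
    rw [norm_sub_rev (w b) (z b)] at this
    linarith
  have hlim : Tendsto (fun s : ℝ => 2 * (M * s)) (𝓝[>] 0) (𝓝 0) := by
    have : Continuous fun s : ℝ => 2 * (M * s) := by fun_prop
    exact (this.tendsto' 0 0 (by simp)).mono_left nhdsWithin_le_nhds
  refine sub_eq_zero.1 (norm_le_zero_iff.1 (ge_of_tendsto hlim ?_))
  filter_upwards [Ioc_mem_nhdsGT ha] using hle

theorem exists_isIntegralCurve_of_start_zero [CompleteSpace E] (hv : IsDissipativeField v M)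
    (y : E) : ∃ z : ℝ → E, z 0 = y ∧ ContinuousOn z (Ici 0) ∧
      ∀ t, 0 < t → HasDerivAt z (v t (z t)) t := by
  choose! Z hZ using fun t => hv.exists_limit_of_start_zero y (t := t)
  have hZy : ∀ t, 0 < t → ‖Z t - y‖ ≤ M * t := fun t ht => by
    obtain ⟨z, hzt, hz⟩ := hv.exists_isIntegralCurveOn ht le_rfl y
    simpa [hzt, norm_sub_rev] using hZ t ht ht le_rfl hzt hz
  have hZderiv : ∀ t, 0 < t → HasDerivAt Z (v t (Z t)) t := fun t ht => by
    obtain ⟨w, hwa, hw⟩ := hv.exists_isIntegralCurveOn (half_pos ht)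
      (show t / 2 ≤ t + 1 by linarith) (Z (t / 2))
    have hwZ : ∀ r ∈ Icc (t / 2) (t + 1), w r = Z r := fun r hr =>
      hv.eq_of_forall_norm_sub_le (fun t ht => hZ t ht) (half_pos ht) hr.1
        (hw.mono (Icc_subset_Icc_right hr.2)) hwa
    have hnhds : Icc (t / 2) (t + 1) ∈ 𝓝 t := Icc_mem_nhds (by linarith) (by linarith)
    have hderiv := (hw t (mem_of_mem_nhds hnhds)).hasDerivAt hnhds
    rw [hwZ t (mem_of_mem_nhds hnhds)] at hderiv
    exact hderiv.congr_of_eventuallyEq (by filter_upwards [hnhds] with r hr using (hwZ r hr).symm)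
  refine ⟨Function.update Z 0 y, by simp, fun t ht => ?_, fun t ht => ?_⟩
  · rcases (show (0 : ℝ) ≤ t from ht).eq_or_lt with rfl | ht
    · have hlim : Tendsto (fun t : ℝ => M * t) (𝓝[≥] 0) (𝓝 0) := by
        have : Continuous fun t : ℝ => M * t := by fun_prop
        exact (this.tendsto' 0 0 (by simp)).mono_left nhdsWithin_le_nhds
      refine continuousWithinAt_update_same.2 (tendsto_iff_norm_sub_tendsto_zero.2 ?_)
      refine squeeze_zero' (Eventually.of_forall fun _ => norm_nonneg _) ?_
        (hlim.mono_left (nhdsWithin_mono 0 sdiff_subset))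
      filter_upwards [self_mem_nhdsWithin] with t ht using hZy t (ht.1.lt_of_ne' ht.2)
    · exact ((continuousAt_update_of_ne ht.ne').2 (hZderiv t ht).continuousAt).continuousWithinAt
  · rw [Function.update_of_ne ht.ne']
    refine (hZderiv t ht).congr_of_eventuallyEq ?_
    filter_upwards [eventually_ne_nhds ht.ne'] with r hr using Function.update_of_ne hr _ _

end IsDissipativeField

end DissipativeFields

section NullSets

open scoped Pointwise

-- The dilates of `A` by the uncountably many factors `exp r` are disjoint and would all have
-- positive measure.
theorem measure_eq_zero_of_forall_smul_notMem {E : Type*} [NormedAddCommGroup E] [NormedSpace ℝ E]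
    [FiniteDimensional ℝ E] [MeasurableSpace E] [BorelSpace E] (μ : Measure E)
    [μ.IsAddHaarMeasure] {A : Set E} (hA : MeasurableSet A)
    (h : ∀ y ∈ A, ∀ c : ℝ, 1 < c → c • y ∉ A) : μ A = 0 := by
  by_contra hpos
  have hdisj : Pairwise (Function.onFun Disjoint fun r : ℝ => Real.exp r • A) := by
    refine (pairwise_disjoint_on _).2 fun r s hrs => Set.disjoint_left.2 ?_
    rintro _ ⟨y, hy, rfl⟩ hyz
    rw [mem_smul_set_iff_inv_smul_mem₀ (Real.exp_pos s).ne', ← Real.exp_neg] at hyz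
    refine h _ hyz (Real.exp (s - r)) (Real.one_lt_exp_iff.2 (sub_pos.2 hrs)) ?_
    rwa [smul_smul, smul_smul, ← Real.exp_add, ← Real.exp_add,
      show s - r + -s + r = 0 by ring, Real.exp_zero, one_smul]
  have hcount := Measure.countable_meas_pos_of_disjoint_iUnion (μ := μ)
    (fun r : ℝ => hA.const_smul₀ (Real.exp r)) hdisj
  have hall : ∀ r : ℝ, 0 < μ (Real.exp r • A) := fun r => by
    rw [Measure.addHaar_smul, abs_of_pos (by positivity)]
    exact ENNReal.mul_pos (ENNReal.ofReal_pos.2 (by positivity)).ne' hpos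
  exact Cardinal.not_countable_real (by simpa only [hall, ofPred_true] using hcount)

end NullSets

section ColeHopf

variable {E : Type*} [NormedAddCommGroup E] {φ ψ : E → ℝ} {M : NNReal} {ε s t : ℝ}

/-- The Cole–Hopf density `y ↦ exp (-|x - y|² / (2εt) - φ(y) / ε)`, not normalized. -/
noncomputable def coleHopfDensity (φ : E → ℝ) (ε t : ℝ) (x y : E) : ℝ :=
  Real.exp (-‖x - y‖ ^ 2 / (2 * ε * t) - φ y / ε)

theorem coleHopfDensity_sub (x z : E) : coleHopfDensity φ ε t x (x - z) =
    Real.exp (-‖z‖ ^ 2 / (2 * ε * t) - φ (x - z) / ε) := by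
  rw [coleHopfDensity, sub_sub_cancel]

theorem coleHopfDensity_pos (x y : E) : 0 < coleHopfDensity φ ε t x y :=
  Real.exp_pos _

theorem continuous_coleHopfDensity (hφ : Continuous φ) (x : E) :
    Continuous (coleHopfDensity φ ε t x) := by
  unfold coleHopfDensity
  fun_prop

theorem continuousAt_coleHopfDensity (hε : 0 < ε) (ht : 0 < t) (x y : E) :
    ContinuousAt (fun s => coleHopfDensity φ ε s x y) t := by
  have : 2 * ε * t ≠ 0 := by positivity
  unfold coleHopfDensity
  fun_prop (disch := assumption)

theorem coleHopfDensity_le_of_le (hε : 0 < ε) (hs : 0 < s) (hst : s ≤ t) (x y : E) :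
    coleHopfDensity φ ε s x y ≤ coleHopfDensity φ ε t x y := by
  unfold coleHopfDensity
  rw [neg_div, neg_div]
  gcongr

theorem coleHopfDensity_sub_le_of_add_le (hε : 0 < ε) {h : E} {c : ℝ}
    (hc : ∀ y, φ y + c ≤ ψ (y + h)) (x z : E) :
    coleHopfDensity ψ ε t (x + h) (x + h - z) ≤
      Real.exp (-c / ε) * coleHopfDensity φ ε t x (x - z) := by
  have hψ := div_le_div_of_nonneg_right (hc (x - z)) hε.le
  rw [sub_add_eq_add_sub] at hψ
  rw [coleHopfDensity_sub, coleHopfDensity_sub, ← Real.exp_add, Real.exp_le_exp]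
  linarith [add_div (φ (x - z)) c ε, neg_div ε c]

theorem add_neg_mul_norm_le_of_lipschitzWith (hφ : LipschitzWith M φ) (y h : E) :
    φ y + -(M * ‖h‖) ≤ φ (y + h) := by
  have := hφ.dist_le_mul y (y + h)
  rw [Real.dist_eq, dist_self_add_right] at this
  linarith [le_abs_self (φ y - φ (y + h))]

theorem coleHopfDensity_sub_le (hφ : LipschitzWith M φ) (hε : 0 < ε) (x x' z : E) :
    coleHopfDensity φ ε t x' (x' - z) ≤
      Real.exp (M * ‖x' - x‖ / ε) * coleHopfDensity φ ε t x (x - z) := by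
  have h := coleHopfDensity_sub_le_of_add_le (t := t) hε
    (add_neg_mul_norm_le_of_lipschitzWith hφ · (x' - x)) x z
  rwa [add_sub_cancel, neg_neg] at h

variable [InnerProductSpace ℝ E]

-- By the triangle inequality, `|x₀ - y|² ≤ 2 |x - y|² + 2 |x - x₀|²`.
theorem coleHopfDensity_le_two_mul (hε : 0 < ε) (ht : 0 < t) (x x₀ y : E) :
    coleHopfDensity φ ε t x y ≤
      Real.exp (‖x - x₀‖ ^ 2 / (2 * ε * t)) * coleHopfDensity φ ε (2 * t) x₀ y := by
  have hsq : ‖x₀ - y‖ ^ 2 ≤ 2 * (‖x - y‖ ^ 2 + ‖x - x₀‖ ^ 2) := by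
    have := parallelogram_law_with_norm ℝ (x - y) (x - x₀)
    rw [sub_sub_sub_cancel_left] at this
    nlinarith [sq_nonneg ‖x - y + (x - x₀)‖]
  have hdiv : ‖x₀ - y‖ ^ 2 / (2 * ε * (2 * t)) ≤
      ‖x - y‖ ^ 2 / (2 * ε * t) + ‖x - x₀‖ ^ 2 / (2 * ε * t) := by
    rw [← add_div, div_le_div_iff₀ (by positivity) (by positivity)]
    nlinarith [mul_le_mul_of_nonneg_right hsq (by positivity : 0 ≤ 2 * ε * t)]
  unfold coleHopfDensity
  rw [← Real.exp_add, Real.exp_le_exp, neg_div, neg_div]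
  linarith

theorem hasGradientAt_coleHopfDensity [CompleteSpace E] (hε : 0 < ε) (ht : 0 < t) (x y : E) :
    HasGradientAt (fun x => coleHopfDensity φ ε t x y)
      (-(ε * t)⁻¹ • coleHopfDensity φ ε t x y • (x - y)) x := by
  have hsq : HasFDerivAt (fun x : E => ‖x - y‖ ^ 2) (2 • innerSL ℝ (x - y)) x := by
    simpa using ((hasFDerivAt_id x).sub_const y).norm_sq
  have hexp := ((hsq.const_mul (-(2 * ε * t)⁻¹)).sub_const (φ y / ε)).exp
  have heq : (fun x => coleHopfDensity φ ε t x y) =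
      fun x => Real.exp (-(2 * ε * t)⁻¹ * ‖x - y‖ ^ 2 - φ y / ε) := by
    funext x
    rw [coleHopfDensity, neg_div, div_eq_inv_mul, neg_mul]
  rw [hasGradientAt_iff_hasFDerivAt, heq, show coleHopfDensity φ ε t x y = _ from congrFun heq x]
  refine hexp.congr_fderiv ?_
  ext w
  simp only [mul_inv_rev, neg_mul, map_sub, neg_smul, smul_neg, neg_apply, smul_apply, sub_apply,
    coe_innerSL_apply, nsmul_eq_mul, Nat.cast_ofNat, smul_eq_mul, map_neg, map_smul,
    InnerProductSpace.toDual_apply_apply, neg_inj]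
  field_simp

theorem norm_coleHopfDensity_smul_le (x y : E) :
    ‖coleHopfDensity φ ε t x y • (x - y)‖ ≤ (1 + ‖x - y‖) * coleHopfDensity φ ε t x y := by
  rw [norm_smul, Real.norm_of_nonneg (coleHopfDensity_pos x y).le, mul_comm]
  exact mul_le_mul_of_nonneg_right (by simp) (coleHopfDensity_pos x y).le

variable [FiniteDimensional ℝ E] [MeasurableSpace E] [BorelSpace E]

theorem integrable_exp_mul_norm_sub_mul_norm_sq (a : ℝ) {c : ℝ} (hc : 0 < c) :
    Integrable fun z : E => Real.exp (a * ‖z‖ - c * ‖z‖ ^ 2) := by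
  have hgauss : Integrable fun z : E => Real.exp (-(c / 2) * ‖z‖ ^ 2) := by
    have h := GaussianFourier.integrable_cexp_neg_mul_sq_norm_add (V := E) (b := ((c / 2 : ℝ) : ℂ))
      (by simpa using hc) 0 0
    refine h.norm.congr (Eventually.of_forall fun z => ?_)
    simp only [Complex.norm_exp]
    norm_cast
    simp
  refine (hgauss.const_mul (Real.exp (a ^ 2 / (2 * c)))).mono'
    (Continuous.aestronglyMeasurable (by fun_prop)) (Eventually.of_forall fun z => ?_)
  have hsq : 0 ≤ (c * ‖z‖ - a) ^ 2 / (2 * c) := by positivity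
  have hexpand : (c * ‖z‖ - a) ^ 2 / (2 * c) = c / 2 * ‖z‖ ^ 2 - a * ‖z‖ + a ^ 2 / (2 * c) := by
    field_simp
    ring
  rw [Real.norm_of_nonneg (Real.exp_pos _).le, ← Real.exp_add, Real.exp_le_exp]
  linarith

theorem integrable_one_add_norm_mul_coleHopfDensity (hφ : LipschitzWith M φ) (hε : 0 < ε)
    (ht : 0 < t) (x : E) : Integrable fun y => (1 + ‖x - y‖) * coleHopfDensity φ ε t x y := by
  have hcont := continuous_coleHopfDensity (ε := ε) (t := t) hφ.continuous x
  suffices h : Integrable fun z => (1 + ‖z‖) * coleHopfDensity φ ε t x (x - z) by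
    simpa using h.comp_sub_left x
  refine ((integrable_exp_mul_norm_sub_mul_norm_sq (1 + M / ε) (c := (2 * ε * t)⁻¹)
    (by positivity)).const_mul (Real.exp (-(φ x / ε)))).mono'
    (Continuous.aestronglyMeasurable (by fun_prop)) (Eventually.of_forall fun z => ?_)
  have hlip := div_le_div_of_nonneg_right
    (add_neg_mul_norm_le_of_lipschitzWith hφ x (-z)) hε.le
  rw [norm_neg, ← sub_eq_add_neg x z] at hlip
  rw [Real.norm_of_nonneg (mul_nonneg (by positivity) (coleHopfDensity_pos _ _).le), ← Real.exp_add]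
  calc (1 + ‖z‖) * coleHopfDensity φ ε t x (x - z)
      ≤ Real.exp ‖z‖ * Real.exp (-‖z‖ ^ 2 / (2 * ε * t) - φ (x - z) / ε) := by
        rw [coleHopfDensity_sub, add_comm]
        gcongr
        exact Real.add_one_le_exp _
    _ ≤ _ := by
        rw [← Real.exp_add, Real.exp_le_exp]
        linear_combination hlip

theorem integrable_coleHopfDensity (hφ : LipschitzWith M φ) (hε : 0 < ε) (ht : 0 < t) (x : E) :
    Integrable (coleHopfDensity φ ε t x) :=
  (integrable_one_add_norm_mul_coleHopfDensity hφ hε ht x).mono'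
    (continuous_coleHopfDensity hφ.continuous x).aestronglyMeasurable
    (Eventually.of_forall fun y => by
      rw [Real.norm_of_nonneg (coleHopfDensity_pos x y).le]
      exact le_mul_of_one_le_left (coleHopfDensity_pos x y).le (by simp))

theorem aestronglyMeasurable_coleHopfDensity_smul (hφ : Continuous φ) (x : E) :
    AEStronglyMeasurable (fun y => coleHopfDensity φ ε t x y • (x - y)) :=
  have := continuous_coleHopfDensity (ε := ε) (t := t) hφ x
  Continuous.aestronglyMeasurable (by fun_prop)

theorem integrable_coleHopfDensity_smul (hφ : LipschitzWith M φ) (hε : 0 < ε) (ht : 0 < t)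
    (x : E) : Integrable fun y => coleHopfDensity φ ε t x y • (x - y) :=
  (integrable_one_add_norm_mul_coleHopfDensity hφ hε ht x).mono'
    (aestronglyMeasurable_coleHopfDensity_smul hφ.continuous x)
    (Eventually.of_forall fun y => norm_coleHopfDensity_smul_le x y)

/-- The total mass of the Cole–Hopf density, a positive solution of the heat equation up to
normalization. -/
noncomputable def coleHopfMass (φ : E → ℝ) (ε t : ℝ) (x : E) : ℝ :=
  ∫ y, coleHopfDensity φ ε t x y

/-- The first moment of the displacement `x - y` under the Cole–Hopf density. -/
noncomputable def coleHopfMoment (φ : E → ℝ) (ε t : ℝ) (x : E) : E :=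
  ∫ y, coleHopfDensity φ ε t x y • (x - y)

theorem coleHopfMass_eq_integral_sub (x : E) :
    coleHopfMass φ ε t x = ∫ z, coleHopfDensity φ ε t x (x - z) :=
  (integral_sub_left_eq_self (coleHopfDensity φ ε t x) volume x).symm

theorem coleHopfMoment_eq_integral_sub (x : E) :
    coleHopfMoment φ ε t x = ∫ z, coleHopfDensity φ ε t x (x - z) • z := by
  rw [coleHopfMoment, ← integral_sub_left_eq_self _ volume x]
  simp only [sub_sub_cancel]

theorem coleHopfMass_pos (hφ : LipschitzWith M φ) (hε : 0 < ε) (ht : 0 < t) (x : E) :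
    0 < coleHopfMass φ ε t x :=
  MeasureTheory.integral_exp_pos (integrable_coleHopfDensity hφ hε ht x)

theorem coleHopfMass_add_le (hφ : LipschitzWith M φ) {M' : NNReal} (hψ : LipschitzWith M' ψ)
    (hε : 0 < ε) (ht : 0 < t) {h : E} {c : ℝ} (hc : ∀ y, φ y + c ≤ ψ (y + h)) (x : E) :
    coleHopfMass ψ ε t (x + h) ≤ Real.exp (-c / ε) * coleHopfMass φ ε t x := by
  rw [coleHopfMass_eq_integral_sub, coleHopfMass_eq_integral_sub, ← integral_const_mul]
  exact integral_mono ((integrable_coleHopfDensity hψ hε ht _).comp_sub_left _)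
    (((integrable_coleHopfDensity hφ hε ht _).comp_sub_left _).const_mul _)
    (coleHopfDensity_sub_le_of_add_le hε hc x)

theorem convexOn_log_coleHopfMass (hφ : LipschitzWith M φ) (hφc : ConcaveOn ℝ univ φ)
    (hε : 0 < ε) (ht : 0 < t) :
    ConvexOn ℝ univ fun x => Real.log (coleHopfMass φ ε t x) := by
  simp only [coleHopfMass_eq_integral_sub, coleHopfDensity_sub]
  refine convexOn_log_integral_exp (fun z => ?_) fun x _ => by
    simpa only [coleHopfDensity_sub] using (integrable_coleHopfDensity hφ hε ht x).comp_sub_left x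
  have hneg := ((hφc.translate_left (-z)).smul (inv_nonneg.2 hε.le)).neg
  rw [preimage_univ] at hneg
  refine (hneg.add_const (-‖z‖ ^ 2 / (2 * ε * t))).congr fun x _ => ?_
  simp [sub_eq_add_neg, div_eq_inv_mul, add_comm]

theorem continuousAt_coleHopfMass (hφ : LipschitzWith M φ) (hε : 0 < ε) (ht : 0 < t) (x : E) :
    ContinuousAt (fun s => coleHopfMass φ ε s x) t := by
  refine continuousAt_of_dominated
    (Eventually.of_forall fun s =>
      (continuous_coleHopfDensity hφ.continuous x).aestronglyMeasurable) ?_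
    (integrable_coleHopfDensity hφ hε (mul_pos two_pos ht) x)
    (Eventually.of_forall fun y => continuousAt_coleHopfDensity hε ht x y)
  filter_upwards [Ioo_mem_nhds ht (lt_two_mul_self ht)] with s hs
  refine Eventually.of_forall fun y => ?_
  rw [Real.norm_of_nonneg (coleHopfDensity_pos x y).le]
  exact coleHopfDensity_le_of_le hε hs.1 hs.2.le x y

theorem continuousAt_coleHopfMoment (hφ : LipschitzWith M φ) (hε : 0 < ε) (ht : 0 < t) (x : E) :
    ContinuousAt (fun s => coleHopfMoment φ ε s x) t := by
  refine continuousAt_of_dominated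
    (Eventually.of_forall fun s => aestronglyMeasurable_coleHopfDensity_smul hφ.continuous x) ?_
    (integrable_one_add_norm_mul_coleHopfDensity hφ hε (mul_pos two_pos ht) x)
    (Eventually.of_forall fun y =>
      (continuousAt_coleHopfDensity hε ht x y).smul continuousAt_const)
  filter_upwards [Ioo_mem_nhds ht (lt_two_mul_self ht)] with s hs
  refine Eventually.of_forall fun y => (norm_coleHopfDensity_smul_le x y).trans ?_
  gcongr
  exact coleHopfDensity_le_of_le hε hs.1 hs.2.le x y

theorem hasGradientAt_coleHopfMass (hφ : LipschitzWith M φ) (hε : 0 < ε) (ht : 0 < t) (x : E) :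
    HasGradientAt (coleHopfMass φ ε t) (-(ε * t)⁻¹ • coleHopfMoment φ ε t x) x := by
  rw [coleHopfMoment, ← integral_smul]
  refine hasGradientAt_integral_of_dominated (Metric.ball_mem_nhds x one_pos)
    (fun w _ => integrable_coleHopfDensity hφ hε ht w)
    ((aestronglyMeasurable_coleHopfDensity_smul hφ.continuous x).const_smul _)
    (bound := fun y => (ε * t)⁻¹ * (2 * Real.exp (1 / (2 * ε * t)) *
      ((1 + ‖x - y‖) * coleHopfDensity φ ε (2 * t) x y)))
    (fun w hw y => ?_)
    (((integrable_one_add_norm_mul_coleHopfDensity hφ hε (mul_pos two_pos ht) x).const_mul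
      _).const_mul _)
    fun w _ y => hasGradientAt_coleHopfDensity hε ht w y
  have hwx : ‖w - x‖ ≤ 1 := (mem_ball_iff_norm.1 hw).le
  have hwy : ‖w - y‖ ≤ 1 + ‖x - y‖ := by
    linarith [norm_sub_le_norm_sub_add_norm_sub w x y]
  rw [norm_smul, norm_neg, Real.norm_of_nonneg (by positivity : 0 ≤ (ε * t)⁻¹)]
  gcongr
  calc _ ≤ (1 + ‖w - y‖) * coleHopfDensity φ ε t w y := norm_coleHopfDensity_smul_le w y
    _ ≤ (2 * (1 + ‖x - y‖)) *
        (Real.exp (1 / (2 * ε * t)) * coleHopfDensity φ ε (2 * t) x y) := by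
      gcongr
      · exact (coleHopfDensity_pos w y).le
      · linarith [norm_nonneg (x - y)]
      · refine (coleHopfDensity_le_two_mul hε ht w x y).trans ?_
        gcongr
        · exact (coleHopfDensity_pos x y).le
        · exact pow_le_one₀ (norm_nonneg _) hwx
    _ = _ := by ring

theorem integral_coleHopfDensity_mul_norm_div_le (hφ : LipschitzWith M φ) (hε : 0 < ε)
    {δ T R : ℝ} (hδ : 0 < δ) (ht : t ∈ Icc δ T) {x : E} (hx : ‖x‖ ≤ R) :
    (∫ z, coleHopfDensity φ ε t x (x - z) * ‖z‖) / coleHopfMass φ ε t x ≤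
      Real.exp (M * R / ε) * (∫ z, coleHopfDensity φ ε T 0 (0 - z) * ‖z‖) /
        (Real.exp (-(M * R / ε)) * coleHopfMass φ ε δ 0) := by
  have ht₀ : 0 < t := hδ.trans_le ht.1
  have hT : 0 < T := ht₀.trans_le ht.2
  have hexp : Real.exp (M * ‖x‖ / ε) ≤ Real.exp (M * R / ε) := by gcongr
  have hint : ∀ {r}, 0 < r → ∀ x,
      Integrable fun z => coleHopfDensity φ ε r x (x - z) * ‖z‖ := fun hr x => by
    simpa [norm_smul, Real.norm_of_nonneg (coleHopfDensity_pos _ _).le] using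
      ((integrable_coleHopfDensity_smul hφ hε hr x).comp_sub_left x).norm
  have hmom : ∫ z, coleHopfDensity φ ε t x (x - z) * ‖z‖ ≤
      Real.exp (M * R / ε) * ∫ z, coleHopfDensity φ ε T 0 (0 - z) * ‖z‖ := by
    rw [← integral_const_mul]
    refine integral_mono (hint ht₀ x) ((hint hT 0).const_mul _) fun z => ?_
    rw [← mul_assoc]
    refine mul_le_mul_of_nonneg_right ?_ (norm_nonneg z)
    refine (coleHopfDensity_sub_le hφ hε 0 x z).trans ?_
    rw [sub_zero]
    exact mul_le_mul hexp (coleHopfDensity_le_of_le hε ht₀ ht.2 _ _) (coleHopfDensity_pos _ _).le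
      (Real.exp_pos _).le
  have hmass : Real.exp (-(M * R / ε)) * coleHopfMass φ ε δ 0 ≤ coleHopfMass φ ε t x := by
    rw [Real.exp_neg, inv_mul_le_iff₀ (Real.exp_pos _)]
    calc coleHopfMass φ ε δ 0 ≤ coleHopfMass φ ε t 0 :=
          integral_mono (integrable_coleHopfDensity hφ hε hδ 0)
            (integrable_coleHopfDensity hφ hε ht₀ 0) (coleHopfDensity_le_of_le hε hδ ht.1 0)
      _ ≤ Real.exp (M * ‖x‖ / ε) * coleHopfMass φ ε t x := by
          have h := coleHopfMass_add_le hφ hφ hε ht₀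
            (add_neg_mul_norm_le_of_lipschitzWith hφ · (-x)) x
          rwa [add_neg_cancel, norm_neg, neg_neg] at h
      _ ≤ _ := mul_le_mul_of_nonneg_right hexp (coleHopfMass_pos hφ hε ht₀ x).le
  exact div_le_div₀ ((integral_nonneg fun z =>
    mul_nonneg (coleHopfDensity_pos _ _).le (norm_nonneg z)).trans hmom) hmom
    (mul_pos (Real.exp_pos _) (coleHopfMass_pos hφ hε hδ 0)) hmass

theorem exp_sub_one_le_mul_exp (a : ℝ) : Real.exp a - 1 ≤ a * Real.exp a := by
  have h := mul_le_mul_of_nonneg_right (Real.one_sub_le_exp_neg a) (Real.exp_pos a).le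
  rw [← Real.exp_add, neg_add_cancel, Real.exp_zero] at h
  linarith

theorem exists_lipschitzOnWith_coleHopfMean (hφ : LipschitzWith M φ) (hε : 0 < ε) {δ : ℝ}
    (hδ : 0 < δ) (T R : ℝ) : ∃ K : NNReal, ∀ t ∈ Icc δ T,
      LipschitzOnWith K (fun x : E => (coleHopfMass φ ε t x)⁻¹ • coleHopfMoment φ ε t x)
        (Metric.closedBall 0 R) := by
  set A := Real.exp (M * R / ε) * (∫ z, coleHopfDensity φ ε T (0 : E) (0 - z) * ‖z‖) /
    (Real.exp (-(M * R / ε)) * coleHopfMass φ ε δ (0 : E))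
  set L := 2 * M / ε * Real.exp (2 * (M * (2 * R) / ε))
  refine ⟨(L * A).toNNReal, fun t ht => LipschitzOnWith.of_dist_le_mul fun x' hx' x hx => ?_⟩
  have ht₀ : 0 < t := hδ.trans_le ht.1
  rw [mem_closedBall_zero_iff] at hx hx'
  have hmoment := integral_coleHopfDensity_mul_norm_div_le hφ hε hδ ht hx
  have hmoment₀ : 0 ≤ (∫ z, coleHopfDensity φ ε t x (x - z) * ‖z‖) / coleHopfMass φ ε t x :=
    div_nonneg (integral_nonneg fun z => mul_nonneg (coleHopfDensity_pos _ _).le (norm_nonneg z))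
      (coleHopfMass_pos hφ hε ht₀ x).le
  have hdist : ‖x' - x‖ ≤ 2 * R := (norm_sub_le x' x).trans (by linarith)
  have hexp : Real.exp (2 * (M * ‖x' - x‖ / ε)) - 1 ≤ L * ‖x' - x‖ := calc
    _ ≤ 2 * (M * ‖x' - x‖ / ε) * Real.exp (2 * (M * ‖x' - x‖ / ε)) := exp_sub_one_le_mul_exp _
    _ ≤ 2 * (M * ‖x' - x‖ / ε) * Real.exp (2 * (M * (2 * R) / ε)) := by gcongr
    _ = L * ‖x' - x‖ := by ring
  have hmean := norm_average_sub_average_le (s := M * ‖x' - x‖ / ε)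
    ((integrable_coleHopfDensity hφ hε ht₀ x).comp_sub_left x)
    ((integrable_coleHopfDensity hφ hε ht₀ x').comp_sub_left x')
    (by simpa using (integrable_coleHopfDensity_smul hφ hε ht₀ x).comp_sub_left x)
    (by simpa using (integrable_coleHopfDensity_smul hφ hε ht₀ x').comp_sub_left x')
    (coleHopfMass_eq_integral_sub x ▸ coleHopfMass_pos hφ hε ht₀ x)
    (fun z => (coleHopfDensity_pos _ _).le)
    (fun z => norm_sub_rev x x' ▸ coleHopfDensity_sub_le hφ hε x' x z)
    (fun z => coleHopfDensity_sub_le hφ hε x x' z)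
  simp only [← coleHopfMass_eq_integral_sub, ← coleHopfMoment_eq_integral_sub] at hmean
  rw [dist_eq_norm, dist_eq_norm, Real.coe_toNNReal _
    (mul_nonneg (by positivity) (hmoment₀.trans hmoment))]
  calc _ ≤ _ := hmean
    _ ≤ L * ‖x' - x‖ * A := mul_le_mul hexp hmoment hmoment₀ (by positivity)
    _ = _ := by ring

end ColeHopf

section BurgersFlow

variable {φ ψ : Plane → ℝ} {M M' : NNReal} {c ε t : ℝ}

theorem burgersPotential_eq (hφ : LipschitzWith M φ) (hε : 0 < ε) (ht : 0 < t) (x : Plane) :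
    burgersPotential φ ε t x =
      ε * Real.log (2 * Real.pi * ε * t) + -ε * Real.log (coleHopfMass φ ε t x) := by
  have hc : (2 * Real.pi * ε * t)⁻¹ ≠ 0 := by positivity
  change -ε * Real.log ((2 * Real.pi * ε * t)⁻¹ * coleHopfMass φ ε t x) = _
  rw [Real.log_mul hc (coleHopfMass_pos hφ hε ht x).ne', Real.log_inv]
  ring

theorem hasGradientAt_burgersPotential (hφ : LipschitzWith M φ) (hε : 0 < ε) (ht : 0 < t)
    (x : Plane) : HasGradientAt (burgersPotential φ ε t)
      (t⁻¹ • (coleHopfMass φ ε t x)⁻¹ • coleHopfMoment φ ε t x) x := by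
  rw [funext (burgersPotential_eq hφ hε ht), hasGradientAt_iff_hasFDerivAt]
  have hlog := (hasGradientAt_coleHopfMass hφ hε ht x).hasFDerivAt.log
    (coleHopfMass_pos hφ hε ht x).ne'
  refine ((hlog.const_mul (-ε)).const_add _).congr_fderiv ?_
  ext w
  simp only [mul_inv_rev, neg_smul, map_neg, map_smul, smul_neg, neg_neg, smul_apply,
    InnerProductSpace.toDual_apply_apply, smul_eq_mul]
  field_simp

theorem burgersVelocity_eq (hφ : LipschitzWith M φ) (hε : 0 < ε) (ht : 0 < t) (x : Plane) :
    burgersVelocity φ ε t x = t⁻¹ • (coleHopfMass φ ε t x)⁻¹ • coleHopfMoment φ ε t x :=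
  (hasGradientAt_burgersPotential hφ hε ht x).gradient

theorem hasGradientAt_burgersPotential_burgersVelocity (hφ : LipschitzWith M φ) (hε : 0 < ε)
    (ht : 0 < t) (x : Plane) :
    HasGradientAt (burgersPotential φ ε t) (burgersVelocity φ ε t x) x :=
  (hasGradientAt_burgersPotential hφ hε ht x).differentiableAt.hasGradientAt

theorem burgersPotential_add_le (hφ : LipschitzWith M φ) (hψ : LipschitzWith M' ψ) (hε : 0 < ε)
    (ht : 0 < t) {h : Plane} (hc : ∀ y, φ y + c ≤ ψ (y + h)) (x : Plane) :
    burgersPotential φ ε t x + c ≤ burgersPotential ψ ε t (x + h) := by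
  have hlog := Real.log_le_log (coleHopfMass_pos hψ hε ht _) (coleHopfMass_add_le hφ hψ hε ht hc x)
  rw [Real.log_mul (Real.exp_ne_zero _) (coleHopfMass_pos hφ hε ht x).ne', Real.log_exp] at hlog
  have hmul := mul_le_mul_of_nonneg_left hlog hε.le
  rw [mul_add, mul_div_cancel₀ _ hε.ne'] at hmul
  rw [burgersPotential_eq hφ hε ht, burgersPotential_eq hψ hε ht]
  linarith

theorem lipschitzWith_burgersPotential (hφ : LipschitzWith M φ) (hε : 0 < ε) (ht : 0 < t) :
    LipschitzWith M (burgersPotential φ ε t) :=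
  LipschitzWith.of_le_add_mul M fun x y => by
    have h := burgersPotential_add_le hφ hφ hε ht
      (add_neg_mul_norm_le_of_lipschitzWith hφ · (y - x)) x
    rw [add_sub_cancel] at h
    rw [dist_eq_norm_sub']
    linarith

theorem concaveOn_burgersPotential (hφ : LipschitzWith M φ) (hφc : ConcaveOn ℝ univ φ)
    (hε : 0 < ε) (ht : 0 < t) : ConcaveOn ℝ univ (burgersPotential φ ε t) := by
  refine (((convexOn_log_coleHopfMass hφ hφc hε ht).smul hε.le).neg.add_const
    (ε * Real.log (2 * Real.pi * ε * t))).congr fun x _ => ?_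
  rw [burgersPotential_eq hφ hε ht]
  simp [add_comm]

theorem burgersPotential_le_add_inner (hφ : LipschitzWith M φ) (hφc : ConcaveOn ℝ univ φ)
    (hε : 0 < ε) (ht : 0 < t) (a b : Plane) : burgersPotential φ ε t b ≤
      burgersPotential φ ε t a + inner ℝ (burgersVelocity φ ε t a) (b - a) := by
  have hneg : HasGradientAt (-burgersPotential φ ε t) (-burgersVelocity φ ε t a) a := by
    rw [hasGradientAt_iff_hasFDerivAt, map_neg]
    exact (hasGradientAt_burgersPotential_burgersVelocity hφ hε ht a).hasFDerivAt.neg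
  have h := add_inner_le_of_convexOn_of_hasGradientAt (concaveOn_burgersPotential hφ hφc hε ht).neg
    (mem_univ a) (mem_univ b) hneg
  simp only [Pi.neg_apply, inner_neg_left] at h
  linarith

theorem le_inner_burgersVelocity (hφ : LipschitzWith M φ) (hφc : ConcaveOn ℝ univ φ)
    (hε : 0 < ε) (ht : 0 < t) {h : Plane} (hc : ∀ y, φ y + c ≤ φ (y + h)) (x : Plane) :
    c ≤ inner ℝ (burgersVelocity φ ε t x) h := by
  have hconc := burgersPotential_le_add_inner hφ hφc hε ht x (x + h)
  rw [add_sub_cancel_left] at hconc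
  linarith [burgersPotential_add_le hφ hφ hε ht hc x]

theorem isDissipativeField_burgersVelocity (hφ : LipschitzWith M φ) (hφc : ConcaveOn ℝ univ φ)
    (hε : 0 < ε) : IsDissipativeField (burgersVelocity φ ε) M where
  norm_le t ht x := by
    have hgrad := (hasGradientAt_burgersPotential_burgersVelocity hφ hε ht x).hasFDerivAt
    simpa using hgrad.le_of_lipschitz (lipschitzWith_burgersPotential hφ hε ht)
  continuousAt t ht x := by
    have hcont := (continuousAt_inv₀ ht.ne').smul
      (((continuousAt_coleHopfMass hφ hε ht x).inv₀ (coleHopfMass_pos hφ hε ht x).ne').smul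
        (continuousAt_coleHopfMoment hφ hε ht x))
    refine hcont.congr ?_
    filter_upwards [lt_mem_nhds ht] with s hs using (burgersVelocity_eq hφ hε hs x).symm
  exists_lipschitzOnWith δ hδ T R := by
    obtain ⟨K, hK⟩ := exists_lipschitzOnWith_coleHopfMean hφ hε hδ T R
    refine ⟨δ⁻¹.toNNReal * K, fun t ht => LipschitzOnWith.of_dist_le_mul fun x hx y hy => ?_⟩
    have ht₀ : 0 < t := hδ.trans_le ht.1
    rw [burgersVelocity_eq hφ hε ht₀, burgersVelocity_eq hφ hε ht₀, dist_smul₀,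
      Real.norm_of_nonneg (inv_nonneg.2 ht₀.le), NNReal.coe_mul,
      Real.coe_toNNReal _ (inv_nonneg.2 hδ.le), mul_assoc]
    gcongr
    · exact ht.1
    · exact (hK t ht).dist_le_mul x hx y hy
  inner_sub_nonpos t ht a b := by
    have hab := burgersPotential_le_add_inner hφ hφc hε ht a b
    have hba := burgersPotential_le_add_inner hφ hφc hε ht b a
    rw [← neg_sub a b, inner_neg_right] at hab
    rw [inner_sub_left]
    linarith

theorem isViscousPath_viscousFlow (hφ : LipschitzWith M φ) (hφc : ConcaveOn ℝ univ φ)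
    (hε : 0 < ε) (y : Plane) : IsViscousPath φ ε y fun t => viscousFlow φ ε t y :=
  Classical.epsilon_spec
    ((isDissipativeField_burgersVelocity hφ hφc hε).exists_isIntegralCurve_of_start_zero y)

theorem norm_sub_le_of_isViscousPath (hφ : LipschitzWith M φ) (hφc : ConcaveOn ℝ univ φ)
    (hε : 0 < ε) {y y' : Plane} {z w : ℝ → Plane} (hz : IsViscousPath φ ε y z)
    (hw : IsViscousPath φ ε y' w) (ht : 0 ≤ t) : ‖z t - w t‖ ≤ ‖y - y'‖ := by
  have h := (isDissipativeField_burgersVelocity hφ hφc hε).norm_sub_le le_rfl ht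
    (hz.2.1.mono Icc_subset_Ici_self) (hw.2.1.mono Icc_subset_Ici_self)
    (fun r hr => hz.2.2 r hr.1) (fun r hr => hw.2.2 r hr.1)
  rwa [hz.1, hw.1] at h

theorem viscousFlow_eq_of_isViscousPath (hφ : LipschitzWith M φ) (hφc : ConcaveOn ℝ univ φ)
    (hε : 0 < ε) {y : Plane} {z : ℝ → Plane} (hz : IsViscousPath φ ε y z) (ht : 0 ≤ t) :
    viscousFlow φ ε t y = z t := by
  have h := norm_sub_le_of_isViscousPath hφ hφc hε (isViscousPath_viscousFlow hφ hφc hε y) hz ht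
  rwa [sub_self, norm_zero, norm_le_zero_iff, sub_eq_zero] at h

end BurgersFlow

section Scaling

variable {φ : Plane → ℝ} {M : NNReal} {c ε t : ℝ}

theorem burgersPotential_smul (hc : 0 < c) (hφc : ∀ y, φ (c • y) = c * φ y) (ε t : ℝ)
    (x : Plane) : burgersPotential φ (c * ε) (c * t) (c • x) = c * burgersPotential φ ε t x := by
  have hdensity : ∀ y : Plane,
      Real.exp (-‖c • x - c • y‖ ^ 2 / (2 * (c * ε) * (c * t)) - φ (c • y) / (c * ε)) =
        Real.exp (-‖x - y‖ ^ 2 / (2 * ε * t) - φ y / ε) := fun y => by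
    rw [← smul_sub, norm_smul, hφc, Real.norm_of_nonneg hc.le, mul_div_mul_left _ _ hc.ne',
      mul_pow, ← mul_neg, show 2 * (c * ε) * (c * t) = c ^ 2 * (2 * ε * t) by ring,
      mul_div_mul_left _ _ (pow_ne_zero 2 hc.ne')]
  have hscale := Measure.integral_comp_smul (volume : Measure Plane)
    (fun y => Real.exp (-‖c • x - y‖ ^ 2 / (2 * (c * ε) * (c * t)) - φ y / (c * ε))) c
  simp_rw [hdensity] at hscale
  unfold burgersPotential
  rw [hscale, finrank_euclideanSpace_fin, smul_eq_mul, abs_of_pos (by positivity),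
    show (2 * Real.pi * (c * ε) * (c * t))⁻¹ = (2 * Real.pi * ε * t)⁻¹ * (c ^ 2)⁻¹ by
      rw [← mul_inv]; ring, ← mul_assoc _ (c ^ 2)⁻¹]
  ring

theorem burgersVelocity_smul (hc : 0 < c) (hφc : ∀ y, φ (c • y) = c * φ y) (ε t : ℝ)
    (x : Plane) : burgersVelocity φ (c * ε) (c * t) (c • x) = burgersVelocity φ ε t x := by
  have hpot : (fun z => burgersPotential φ (c * ε) (c * t) (c • z)) =
      c • burgersPotential φ ε t := funext (burgersPotential_smul hc hφc ε t)
  have hfderiv := congrArg (fun f => fderiv ℝ f x) hpot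
  simp only [fderiv_comp_smul, fderiv_const_smul_field, Pi.smul_apply] at hfderiv
  unfold burgersVelocity gradient
  rw [smul_right_injective _ hc.ne' hfderiv]

theorem viscousFlow_smul (hφ : LipschitzWith M φ) (hφconc : ConcaveOn ℝ univ φ) (hc : 0 < c)
    (hφc : ∀ y, φ (c • y) = c * φ y) (hε : 0 < ε) (ht : 0 ≤ t) (y : Plane) :
    viscousFlow φ (c * ε) (c * t) (c • y) = c • viscousFlow φ ε t y := by
  obtain ⟨hstart, hcont, hderiv⟩ := isViscousPath_viscousFlow hφ hφconc hε y
  have hscaled : IsViscousPath φ (c * ε) (c • y) fun s => c • viscousFlow φ ε (c⁻¹ * s) y := by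
    refine ⟨by simpa using congrArg (c • ·) hstart, ?_, fun s hs => ?_⟩
    · exact (hcont.comp (by fun_prop) fun s hs =>
        mul_nonneg (inv_nonneg.2 hc.le) hs).const_smul c
    · have htime : HasDerivAt (fun s : ℝ => c⁻¹ * s) c⁻¹ s := by
        simpa using (hasDerivAt_id s).const_mul c⁻¹
      have h := ((hderiv _ (by positivity)).scomp s htime).const_smul c
      rwa [smul_smul, mul_inv_cancel₀ hc.ne', one_smul, ← burgersVelocity_smul hc hφc,
        mul_inv_cancel_left₀ hc.ne'] at h
  rw [viscousFlow_eq_of_isViscousPath hφ hφconc (mul_pos hc hε) hscaled (mul_nonneg hc.le ht),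
    inv_mul_cancel_left₀ hc.ne']

end Scaling

section FiniteFamily

variable {ι : Type*} [Fintype ι] {φ : Plane → ℝ} {M : NNReal} {ε t : ℝ}

theorem coleHopfMass_eq_mul_exp_burgersPotential (hφ : LipschitzWith M φ) (hε : 0 < ε)
    (ht : 0 < t) (x : Plane) : coleHopfMass φ ε t x =
      2 * Real.pi * ε * t * Real.exp (-burgersPotential φ ε t x / ε) := by
  have hscale : 0 < 2 * Real.pi * ε * t := by positivity
  have hexponent : -burgersPotential φ ε t x / ε =
      Real.log (coleHopfMass φ ε t x) - Real.log (2 * Real.pi * ε * t) := by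
    rw [burgersPotential_eq hφ hε ht]
    field_simp
    ring
  rw [hexponent, Real.exp_sub, Real.exp_log (coleHopfMass_pos hφ hε ht x), Real.exp_log hscale,
    mul_div_cancel₀ _ hscale.ne']

theorem sub_mul_log_card_le_burgersPotential [Nonempty ι] {ψ : ι → Plane → ℝ} {L : ι → NNReal}
    (hφ : LipschitzWith M φ) (hψ : ∀ i, LipschitzWith (L i) (ψ i)) (hε : 0 < ε) (ht : 0 < t)
    (hle : ∀ y, ∃ i, ψ i y ≤ φ y) {x : Plane} {w : ℝ} (hw : ∀ i, w ≤ burgersPotential (ψ i) ε t x) :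
    w - ε * Real.log (Fintype.card ι) ≤ burgersPotential φ ε t x := by
  have hint := fun i => integrable_coleHopfDensity (hψ i) hε ht x
  have hdensity : ∀ y, coleHopfDensity φ ε t x y ≤ ∑ i, coleHopfDensity (ψ i) ε t x y := fun y => by
    obtain ⟨i, hi⟩ := hle y
    have hdensity_le : coleHopfDensity φ ε t x y ≤ coleHopfDensity (ψ i) ε t x y :=
      Real.exp_le_exp.2 (sub_le_sub_left (div_le_div_of_nonneg_right hi hε.le) _)
    exact hdensity_le.trans <| Finset.single_le_sum (f := fun i => coleHopfDensity (ψ i) ε t x y)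
      (fun i _ => (coleHopfDensity_pos x y).le) (Finset.mem_univ i)
  have hmass : coleHopfMass φ ε t x ≤
      2 * Real.pi * ε * t * (Fintype.card ι * Real.exp (-w / ε)) := calc
    coleHopfMass φ ε t x ≤ ∑ i, coleHopfMass (ψ i) ε t x := by
      unfold coleHopfMass
      rw [← integral_finsetSum _ fun i _ => hint i]
      exact integral_mono (integrable_coleHopfDensity hφ hε ht x)
        (integrable_finsetSum _ fun i _ => hint i) hdensity
    _ ≤ ∑ _i : ι, 2 * Real.pi * ε * t * Real.exp (-w / ε) := by
      refine Finset.sum_le_sum fun i _ => ?_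
      rw [coleHopfMass_eq_mul_exp_burgersPotential (hψ i) hε ht]
      gcongr
      exact hw i
    _ = 2 * Real.pi * ε * t * (Fintype.card ι * Real.exp (-w / ε)) := by
      rw [Finset.sum_const, Finset.card_univ, nsmul_eq_mul]
      ring
  rw [coleHopfMass_eq_mul_exp_burgersPotential hφ hε ht, mul_le_mul_iff_right₀ (by positivity),
    ← Real.exp_log (show (0 : ℝ) < Fintype.card ι by exact_mod_cast Fintype.card_pos),
    ← Real.exp_add, Real.exp_le_exp] at hmass
  have hmul := mul_le_mul_of_nonneg_right hmass hε.le
  rw [add_mul, div_mul_cancel₀ _ hε.ne', div_mul_cancel₀ _ hε.ne'] at hmul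
  linarith

/-- Completing the square: the Cole–Hopf density of a linear datum is a Gaussian centered at
`x - t • v`. -/
theorem burgersPotential_inner (hε : 0 < ε) (ht : 0 < t) (v x : Plane) :
    burgersPotential (fun y => inner ℝ v y) ε t x = inner ℝ v x - t * ‖v‖ ^ 2 / 2 := by
  have hdensity : ∀ y, Real.exp (-‖x - y‖ ^ 2 / (2 * ε * t) - inner ℝ v y / ε) =
      Real.exp (-(inner ℝ v x - t * ‖v‖ ^ 2 / 2) / ε) *
        Real.exp (-(2 * ε * t)⁻¹ * ‖x - t • v - y‖ ^ 2) := by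
    intro y
    have hsq : ‖x - t • v - y‖ ^ 2 =
        ‖x - y‖ ^ 2 - 2 * t * (inner ℝ v x - inner ℝ v y) + t ^ 2 * ‖v‖ ^ 2 := by
      rw [sub_right_comm, norm_sub_sq_real, inner_smul_right, norm_smul, mul_pow, Real.norm_eq_abs,
        sq_abs, real_inner_comm, inner_sub_right]
      ring
    rw [← Real.exp_add, hsq]
    congr 1
    field_simp
    ring
  have hgauss := GaussianFourier.integral_rexp_neg_mul_sq_norm (V := Plane) (b := (2 * ε * t)⁻¹)
    (by positivity)
  rw [finrank_euclideanSpace_fin, Nat.cast_ofNat, div_self two_ne_zero, Real.rpow_one] at hgauss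
  simp only [burgersPotential, hdensity]
  rw [integral_const_mul, integral_sub_left_eq_self
    (fun y : Plane => Real.exp (-(2 * ε * t)⁻¹ * ‖y‖ ^ 2)) volume (x - t • v), hgauss,
    show (2 * Real.pi * ε * t)⁻¹ * (Real.exp (-(inner ℝ v x - t * ‖v‖ ^ 2 / 2) / ε) *
      (Real.pi / (2 * ε * t)⁻¹)) = Real.exp (-(inner ℝ v x - t * ‖v‖ ^ 2 / 2) / ε) by
        field_simp, Real.log_exp]
  field_simp

end FiniteFamily

section MinInner

variable {E ι : Type*} [NormedAddCommGroup E] [InnerProductSpace ℝ E]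

theorem lipschitzWith_inner_left (w : E) : LipschitzWith ‖w‖₊ fun y : E => inner ℝ w y :=
  LipschitzWith.of_dist_le_mul fun x y => by
    rw [Real.dist_eq, ← inner_sub_right, dist_eq_norm]
    exact abs_real_inner_le_norm _ _

variable [Fintype ι] [Nonempty ι] (v : ι → E) {s t : ℝ}

/-- The velocity potential `min_i v_i · y` of a finite family of velocities: the initial datum of
the flow. For the vertices of a triangle it is `threeSectorPotential`. -/
noncomputable def minInner (y : E) : ℝ :=
  Finset.univ.inf' Finset.univ_nonempty fun i => inner ℝ (v i) y

/-- The inviscid potential `min_i (v_i · x - t |v_i|² / 2)`: the limit as `ε → 0⁺` of the viscous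
potentials started at `minInner v`. -/
noncomputable def inviscidPotential (t : ℝ) (x : E) : ℝ :=
  Finset.univ.inf' Finset.univ_nonempty fun i => inner ℝ (v i) x - t * ‖v i‖ ^ 2 / 2

theorem minInner_le (i : ι) (y : E) : minInner v y ≤ inner ℝ (v i) y :=
  Finset.inf'_le _ (Finset.mem_univ i)

theorem exists_minInner_eq (y : E) : ∃ i, minInner v y = inner ℝ (v i) y :=
  (Finset.exists_mem_eq_inf' Finset.univ_nonempty _).imp fun _ h => h.2

theorem inviscidPotential_le (i : ι) (t : ℝ) (x : E) :
    inviscidPotential v t x ≤ inner ℝ (v i) x - t * ‖v i‖ ^ 2 / 2 :=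
  Finset.inf'_le _ (Finset.mem_univ i)

theorem exists_inviscidPotential_eq (t : ℝ) (x : E) :
    ∃ i, inviscidPotential v t x = inner ℝ (v i) x - t * ‖v i‖ ^ 2 / 2 :=
  (Finset.exists_mem_eq_inf' Finset.univ_nonempty _).imp fun _ h => h.2

theorem concaveOn_minInner : ConcaveOn ℝ univ (minInner v) := by
  refine ⟨convex_univ, fun a _ b _ p q hp hq _ => ?_⟩
  obtain ⟨i, hi⟩ := exists_minInner_eq v (p • a + q • b)
  rw [hi, inner_add_right, inner_smul_right, inner_smul_right, smul_eq_mul, smul_eq_mul]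
  gcongr
  exacts [minInner_le v i a, minInner_le v i b]

theorem minInner_add_le {h : E} {c : ℝ} (hc : ∀ i, c ≤ inner ℝ (v i) h) (y : E) :
    minInner v y + c ≤ minInner v (y + h) := by
  obtain ⟨i, hi⟩ := exists_minInner_eq v (y + h)
  rw [hi, inner_add_right]
  exact add_le_add (minInner_le v i y) (hc i)

theorem lipschitzWith_minInner : LipschitzWith (∑ i, ‖v i‖₊) (minInner v) := by
  refine LipschitzWith.of_le_add_mul _ fun x y => ?_
  obtain ⟨i, hi⟩ := exists_minInner_eq v y
  have hnorm : ‖v i‖₊ ≤ ∑ i, ‖v i‖₊ :=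
    Finset.single_le_sum (f := fun i => ‖v i‖₊) (fun _ _ => zero_le) (Finset.mem_univ i)
  have hlip := ((lipschitzWith_inner_left (v i)).weaken hnorm).le_add_mul x y
  rw [hi]
  exact (minInner_le v i x).trans hlip

theorem minInner_smul {c : ℝ} (hc : 0 ≤ c) (y : E) : minInner v (c • y) = c * minInner v y := by
  simp only [minInner, inner_smul_right]
  exact (Finset.apply_inf'_eq_inf'_comp _ _ fun a b => mul_min_of_nonneg a b hc).symm

theorem inviscidPotential_eq_of_le {x : E} {i : ι} (h : ∀ j,
    inner ℝ (v i) x - t * ‖v i‖ ^ 2 / 2 ≤ inner ℝ (v j) x - t * ‖v j‖ ^ 2 / 2) :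
    inviscidPotential v t x = inner ℝ (v i) x - t * ‖v i‖ ^ 2 / 2 :=
  (inviscidPotential_le v i t x).antisymm (Finset.le_inf' _ _ fun j _ => h j)

theorem inviscidPotential_add_smul_eq (hst : s ≤ t) {y : E} {i : ι}
    (h : inviscidPotential v t (y + t • v i) =
      inner ℝ (v i) (y + t • v i) - t * ‖v i‖ ^ 2 / 2) :
    inviscidPotential v s (y + s • v i) =
      inner ℝ (v i) (y + s • v i) - s * ‖v i‖ ^ 2 / 2 := by
  refine inviscidPotential_eq_of_le v fun j => ?_
  have hj := h.ge.trans (inviscidPotential_le v j t _)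
  have hsq : 0 ≤ (t - s) * ‖v i - v j‖ ^ 2 := mul_nonneg (sub_nonneg.2 hst) (sq_nonneg _)
  rw [norm_sub_sq_real, real_inner_comm] at hsq
  simp only [inner_add_right, inner_smul_right, real_inner_self_eq_norm_sq] at hj ⊢
  linarith

end MinInner

section AdhesionFlow

variable {ι : Type*} [Fintype ι] [Nonempty ι] (v : ι → Plane) {ε s t : ℝ}

theorem burgersPotential_minInner_le (hε : 0 < ε) (ht : 0 < t) (x : Plane) :
    burgersPotential (minInner v) ε t x ≤ inviscidPotential v t x := by
  obtain ⟨i, hi⟩ := exists_inviscidPotential_eq v t x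
  have h := burgersPotential_add_le (lipschitzWith_minInner v) (lipschitzWith_inner_left (v i)) hε
    ht (h := 0) (c := 0) (fun y => by simpa using minInner_le v i y) x
  rwa [add_zero, add_zero, burgersPotential_inner hε ht, ← hi] at h

theorem inviscidPotential_sub_le_burgersPotential (hε : 0 < ε) (ht : 0 < t) (x : Plane) :
    inviscidPotential v t x - ε * Real.log (Fintype.card ι) ≤
      burgersPotential (minInner v) ε t x :=
  sub_mul_log_card_le_burgersPotential (lipschitzWith_minInner v)
    (fun i => lipschitzWith_inner_left (v i)) hε ht
    (fun y => (exists_minInner_eq v y).imp fun _ h => h.ge)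
    fun i => (inviscidPotential_le v i t x).trans (burgersPotential_inner hε ht (v i) x).ge

theorem inner_burgersVelocity_sub_le (hε : 0 < ε) (ht : 0 < t) (x y : Plane) :
    inner ℝ (burgersVelocity (minInner v) ε t x) (x - y) ≤
      inviscidPotential v t x - inviscidPotential v t y + ε * Real.log (Fintype.card ι) := by
  have hconc := burgersPotential_le_add_inner (lipschitzWith_minInner v) (concaveOn_minInner v)
    hε ht x y
  rw [← neg_sub x y, inner_neg_right] at hconc
  linarith [burgersPotential_minInner_le v hε ht x,
    inviscidPotential_sub_le_burgersPotential v hε ht y]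

theorem isViscousPath_viscousFlow_minInner (hε : 0 < ε) (y : Plane) :
    IsViscousPath (minInner v) ε y fun t => viscousFlow (minInner v) ε t y :=
  isViscousPath_viscousFlow (lipschitzWith_minInner v) (concaveOn_minInner v) hε y

theorem viscousFlow_minInner_zero (hε : 0 < ε) (y : Plane) : viscousFlow (minInner v) ε 0 y = y :=
  (isViscousPath_viscousFlow_minInner v hε y).1

theorem norm_sq_viscousFlow_sub_le {ε' : ℝ} (hε : 0 < ε) (hε' : 0 < ε') (ht : 0 ≤ t) (y : Plane) :
    ‖viscousFlow (minInner v) ε t y - viscousFlow (minInner v) ε' t y‖ ^ 2 ≤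
      2 * ((ε + ε') * Real.log (Fintype.card ι)) * t := by
  obtain ⟨-, hcont, hderiv⟩ := isViscousPath_viscousFlow_minInner v hε y
  obtain ⟨-, hcont', hderiv'⟩ := isViscousPath_viscousFlow_minInner v hε' y
  have h := norm_sq_sub_le_of_inner_sub_le (W := inviscidPotential v) ht
    (hcont.mono Icc_subset_Ici_self) (hcont'.mono Icc_subset_Ici_self)
    (fun r hr => hderiv r hr.1) (fun r hr => hderiv' r hr.1)
    (fun r hr => inner_burgersVelocity_sub_le v hε hr.1 _)
    (fun r hr => inner_burgersVelocity_sub_le v hε' hr.1 _)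
  rw [viscousFlow_minInner_zero v hε, viscousFlow_minInner_zero v hε', sub_self, norm_zero] at h
  linarith

theorem tendsto_viscousFlow (ht : 0 ≤ t) (y : Plane) :
    Tendsto (fun ε => viscousFlow (minInner v) ε t y) (𝓝[>] 0)
      (𝓝 (adhesionFlow (minInner v) t y)) := by
  refine tendsto_nhds_limUnder (cauchy_map_iff_exists_tendsto.1 (Metric.cauchy_iff.2 ?_))
  refine ⟨inferInstance, fun η hη => ?_⟩
  have hlim : Tendsto (fun κ : ℝ => 2 * ((κ + κ) * Real.log (Fintype.card ι)) * t) (𝓝[>] 0)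
      (𝓝 0) := tendsto_nhdsWithin_of_tendsto_nhds <|
    Continuous.tendsto' (by fun_prop) _ _ (by simp)
  obtain ⟨κ, hκη, hκ⟩ :=
    ((hlim.eventually (gt_mem_nhds (pow_pos hη 2))).and self_mem_nhdsWithin).exists
  refine ⟨_, image_mem_map (Ioo_mem_nhdsGT hκ), ?_⟩
  rintro _ ⟨ε, hε, rfl⟩ _ ⟨ε', hε', rfl⟩
  rw [dist_eq_norm]
  refine lt_of_pow_lt_pow_left₀ 2 hη.le (lt_of_le_of_lt ?_ hκη)
  refine (norm_sq_viscousFlow_sub_le v hε.1 hε'.1 ht y).trans ?_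
  have : 0 ≤ Real.log (Fintype.card ι) := Real.log_natCast_nonneg _
  gcongr
  exacts [hε.2.le, hε'.2.le]

theorem continuous_adhesionFlow (ht : 0 ≤ t) : Continuous (adhesionFlow (minInner v) t) := by
  refine (LipschitzWith.of_dist_le_mul (K := 1) fun y y' => ?_).continuous
  rw [dist_eq_norm, dist_eq_norm, NNReal.coe_one, one_mul]
  refine le_of_tendsto ((tendsto_viscousFlow v ht y).sub (tendsto_viscousFlow v ht y')).norm ?_
  filter_upwards [self_mem_nhdsWithin] with ε hε
  exact norm_sub_le_of_isViscousPath (lipschitzWith_minInner v) (concaveOn_minInner v) hε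
    (isViscousPath_viscousFlow_minInner v hε y) (isViscousPath_viscousFlow_minInner v hε y') ht

theorem adhesionFlow_eq_add_smul (ht : 0 ≤ t) {y : Plane} {i : ι}
    (h : inviscidPotential v t (y + t • v i) =
      inner ℝ (v i) (y + t • v i) - t * ‖v i‖ ^ 2 / 2) :
    adhesionFlow (minInner v) t y = y + t • v i := by
  have hline : ∀ r : ℝ, HasDerivAt (fun r : ℝ => y + r • v i) (v i) r := fun r => by
    simpa using ((hasDerivAt_id r).smul_const (v i)).const_add y
  have hbound : ∀ᶠ ε in 𝓝[>] (0 : ℝ), ‖viscousFlow (minInner v) ε t y - (y + t • v i)‖ ^ 2 ≤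
      2 * (ε * Real.log (Fintype.card ι)) * t := by
    filter_upwards [self_mem_nhdsWithin] with ε hε
    obtain ⟨-, hcont, hderiv⟩ := isViscousPath_viscousFlow_minInner v hε y
    have hdist := norm_sq_sub_le_of_inner_sub_le (W := inviscidPotential v) (η' := 0) ht
      (hcont.mono Icc_subset_Ici_self) (fun r _ => (hline r).continuousAt.continuousWithinAt)
      (fun r hr => hderiv r hr.1) (fun r _ => hline r)
      (fun r hr => inner_burgersVelocity_sub_le v hε hr.1 _) fun r hr p => by
        rw [inviscidPotential_add_smul_eq v hr.2.le h, inner_sub_right]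
        linarith [inviscidPotential_le v i r p]
    rw [viscousFlow_minInner_zero v hε, zero_smul, add_zero, sub_self, norm_zero] at hdist
    linarith
  have hlim : Tendsto (fun ε : ℝ => 2 * (ε * Real.log (Fintype.card ι)) * t) (𝓝[>] 0) (𝓝 0) :=
    tendsto_nhdsWithin_of_tendsto_nhds <| Continuous.tendsto' (by fun_prop) _ _ (by simp)
  refine tendsto_nhds_unique (tendsto_viscousFlow v ht y) ?_
  rw [tendsto_iff_norm_sub_tendsto_zero]
  simpa using (squeeze_zero' (Eventually.of_forall fun _ => sq_nonneg _) hbound hlim).sqrt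

theorem inner_adhesionFlow_add_le {h : Plane} {c : ℝ} (hc : ∀ i, c ≤ inner ℝ (v i) h)
    (hs : 0 ≤ s) (hst : s ≤ t) (y : Plane) :
    inner ℝ (adhesionFlow (minInner v) s y) h + c * (t - s) ≤
      inner ℝ (adhesionFlow (minInner v) t y) h := by
  refine le_of_tendsto_of_tendsto
    (((tendsto_viscousFlow v hs y).inner tendsto_const_nhds).add_const _)
    ((tendsto_viscousFlow v (hs.trans hst) y).inner tendsto_const_nhds) ?_
  filter_upwards [self_mem_nhdsWithin] with ε hε
  obtain ⟨-, hcont, hderiv⟩ := isViscousPath_viscousFlow_minInner v hε y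
  have hderiv_inner : ∀ r ∈ interior (Icc s t), HasDerivAt
      (fun r => inner ℝ (viscousFlow (minInner v) ε r y) h)
      (inner ℝ (burgersVelocity (minInner v) ε r (viscousFlow (minInner v) ε r y)) h) r := by
    rw [interior_Icc]
    exact fun r hr => by simpa using (hderiv r (hs.trans_lt hr.1)).inner ℝ (hasDerivAt_const r h)
  have hgrowth := (convex_Icc s t).mul_sub_le_image_sub_of_le_deriv (C := c)
    ((hcont.mono fun r hr => hs.trans hr.1).inner continuousOn_const)
    (fun r hr => (hderiv_inner r hr).differentiableAt.differentiableWithinAt)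
    (fun r hr => (hderiv_inner r hr).deriv.ge.trans' <| by
      rw [interior_Icc] at hr
      exact le_inner_burgersVelocity (lipschitzWith_minInner v) (concaveOn_minInner v) hε
        (hs.trans_lt hr.1) (minInner_add_le v hc) _)
    s (left_mem_Icc.2 hst) t (right_mem_Icc.2 hst) hst
  linarith

theorem adhesionFlow_smul {c : ℝ} (hc : 0 < c) (ht : 0 ≤ t) (y : Plane) :
    adhesionFlow (minInner v) (c * t) (c • y) = c • adhesionFlow (minInner v) t y := by
  have hscale : Tendsto (fun ε : ℝ => c * ε) (𝓝[>] 0) (𝓝[>] 0) :=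
    tendsto_nhdsWithin_iff.2 ⟨tendsto_nhdsWithin_of_tendsto_nhds <|
      Continuous.tendsto' (by fun_prop) _ _ (by simp),
      eventually_mem_nhdsWithin.mono fun ε hε => mul_pos hc hε⟩
  refine tendsto_nhds_unique
    ((tendsto_viscousFlow v (mul_nonneg hc.le ht) (c • y)).comp hscale) ?_
  refine ((tendsto_viscousFlow v ht y).const_smul c).congr' ?_
  filter_upwards [self_mem_nhdsWithin] with ε hε
  exact (viscousFlow_smul (lipschitzWith_minInner v) (concaveOn_minInner v) hc
    (minInner_smul v hc.le) hε ht y).symm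

theorem volume_adhesionFlow_eq_smul {q : Plane} (hq : q ∉ convexHull ℝ (range v)) (ht : 0 < t) :
    volume {y | adhesionFlow (minInner v) t y = t • q} = 0 := by
  obtain ⟨f, u, hfq, hfv⟩ := geometric_hahn_banach_point_closed (convex_convexHull ℝ _)
    ((finite_range v).isCompact_convexHull (𝕜 := ℝ)).isClosed hq
  obtain ⟨h, rfl⟩ := (InnerProductSpace.toDual ℝ Plane).surjective f
  simp only [InnerProductSpace.toDual_apply_apply] at hfq hfv
  have hu : ∀ i, u ≤ inner ℝ (v i) h := fun i => by
    rw [real_inner_comm]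
    exact (hfv _ (subset_convexHull ℝ _ (mem_range_self i))).le
  refine measure_eq_zero_of_forall_smul_notMem volume
    (isClosed_eq (continuous_adhesionFlow v ht.le) continuous_const).measurableSet
    fun y (hy : adhesionFlow (minInner v) t y = t • q) c hc
      (hcy : adhesionFlow (minInner v) t (c • y) = t • q) => ?_
  have hc₀ : 0 < c := one_pos.trans hc
  have hscaled := adhesionFlow_smul v hc₀ ht.le y
  have hprogress := inner_adhesionFlow_add_le v hu ht.le
    (le_mul_of_one_le_left ht.le hc.le) (c • y)
  rw [hscaled, hy, hcy, inner_smul_left, inner_smul_left, inner_smul_left, real_inner_comm]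
    at hprogress
  simp only [conj_trivial] at hprogress
  nlinarith [mul_pos ht (sub_pos.2 hc)]

end AdhesionFlow

section CyclicPolygons

variable {E ι : Type*} [NormedAddCommGroup E] [InnerProductSpace ℝ E] (v : ι → E) (q : E) (t : ℝ)

/-- The convex set `t (q - co {v_i})`, which for a triangle with circumcenter `q` is
`backTriangle`. -/
def backHull : Set E :=
  (fun p => t • (q - p)) '' convexHull ℝ (range v)

/-- The open sector at time `t` in which particles move with velocity `v i`, when all the `v j` are
equidistant from `q`, so that all sectors meet at `t • q`. -/
def openSector (i : ι) : Set E :=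
  {x | ∀ j, v j ≠ v i → inner ℝ (v i - v j) (x - t • q) < 0}

variable {v q t}

theorem backHull_eq_convexHull :
    backHull v q t = convexHull ℝ (range fun i => t • q - t • v i) := by
  have h := (t • (AffineMap.const ℝ E q - AffineMap.id ℝ E)).image_convexHull (range v)
  rw [← range_comp] at h
  exact h.trans (congrArg (convexHull ℝ) (congrArg range (funext fun i => smul_sub t q (v i))))

theorem smul_sub_smul_mem_backHull (i : ι) : t • q - t • v i ∈ backHull v q t := by
  rw [backHull_eq_convexHull]
  exact subset_convexHull ℝ _ (mem_range_self i)

theorem interior_backHull_nonempty [FiniteDimensional ℝ E] (ht : t ≠ 0)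
    (hspan : affineSpan ℝ (range v) = ⊤) : (interior (backHull v q t)).Nonempty := by
  have hopen : IsOpenMap fun p : E => t • (q - p) :=
    (isOpenMap_smul₀ ht).comp (Homeomorph.subLeft q).isOpenMap
  exact ((interior_convexHull_nonempty_iff_affineSpan_eq_top.2 hspan).image _).mono
    (hopen.image_interior_subset _)

theorem isOpen_openSector [Finite ι] (i : ι) : IsOpen (openSector v q t i) := by
  simp only [openSector, ofPred_forall]
  exact isOpen_iInter_of_finite fun j => isOpen_iInter_of_finite fun _ =>
    isOpen_lt (by fun_prop) continuous_const

theorem inner_sub_pos_of_dist_eq {a b q : E} (h : dist a q = dist b q) (hab : b ≠ a) :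
    0 < inner ℝ (a - b) (a - q) := by
  have hnorm : ‖b - q‖ ^ 2 = ‖a - q‖ ^ 2 := by rw [← dist_eq_norm, ← dist_eq_norm, h]
  have hsq : 0 < ‖a - b‖ ^ 2 := pow_pos (norm_sub_pos_iff.2 hab.symm) 2
  rw [← sub_sub_sub_cancel_left q b a, norm_sub_sq_real, real_inner_comm] at hnorm
  linarith

theorem smul_mem_closure_openSector {r : ℝ} (hq : ∀ i, dist (v i) q = r) (i : ι) :
    t • q ∈ closure (openSector v q t i) := by
  have hlim : Tendsto (fun s : ℝ => t • q - s • (v i - q)) (𝓝[>] 0) (𝓝 (t • q)) :=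
    tendsto_nhdsWithin_of_tendsto_nhds <| Continuous.tendsto' (by fun_prop) _ _ (by simp)
  refine mem_closure_of_tendsto hlim ?_
  filter_upwards [self_mem_nhdsWithin] with s (hs : 0 < s) j hj
  rw [sub_sub_cancel_left, inner_neg_right, inner_smul_right, neg_lt_zero]
  exact mul_pos hs (inner_sub_pos_of_dist_eq ((hq i).trans (hq j).symm) hj)

theorem inner_sub_le_of_mem_openSector {r : ℝ} (hq : ∀ i, dist (v i) q = r) {i : ι} {x : E}
    (hx : x ∈ openSector v q t i) (j : ι) :
    inner ℝ (v i) x - t * ‖v i‖ ^ 2 / 2 ≤ inner ℝ (v j) x - t * ‖v j‖ ^ 2 / 2 := by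
  obtain hj | hj := eq_or_ne (v j) (v i)
  · rw [hj]
  have hdist : t * ‖v i - q‖ ^ 2 = t * ‖v j - q‖ ^ 2 := by
    rw [← dist_eq_norm, ← dist_eq_norm, hq, hq]
  have hsector := hx j hj
  rw [norm_sub_sq_real, norm_sub_sq_real] at hdist
  simp only [inner_sub_left, inner_sub_right, inner_smul_right] at hsector
  linarith

end CyclicPolygons

section Reconstruction

variable {ι : Type*} {v : ι → Plane} {q : Plane} {t : ℝ} {D U : Set Plane} {T : Plane → Plane}

theorem IsMonotoneMapOn.inner_sub_nonneg_of_frequently (hmono : IsMonotoneMapOn D T U)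
    {a p y : Plane} (hU : U ∈ 𝓝 (p - a))
    (hfreq : ∃ᶠ x in 𝓝 p, x - a ∈ D ∧ T (x - a) = x) (hy : y ∈ U ∩ D) :
    0 ≤ inner ℝ (T y - p) (y - (p - a)) := by
  have hcont : ContinuousAt (fun x => inner ℝ (T y - x) (y - (x - a))) p := by fun_prop
  have hsub : Tendsto (fun x => x - a) (𝓝 p) (𝓝 (p - a)) :=
    Continuous.tendsto (by fun_prop) p
  refine ge_of_tendsto_of_frequently hcont ?_
  refine (hfreq.and_eventually (hsub hU)).mono fun x ⟨⟨hxD, hxT⟩, hxU⟩ => ?_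
  have h := hmono y hy (x - a) ⟨hxU, hxD⟩
  rwa [hxT] at h

theorem IsMonotoneMapOn.eq_smul_of_mem_interior_backHull (hmono : IsMonotoneMapOn D T U)
    (hU : U ∈ 𝓝ˢ (backHull v q t))
    (hfreq : ∀ i, ∃ᶠ x in 𝓝 (t • q), x - t • v i ∈ D ∧ T (x - t • v i) = x) {y : Plane}
    (hy : y ∈ interior (backHull v q t)) (hyD : y ∈ D) : T y = t • q := by
  have hvertices : range (fun i => t • q - t • v i) ⊆ {x | inner ℝ (T y - t • q) x ≤
      inner ℝ (T y - t • q) y} := by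
    rintro _ ⟨i, rfl⟩
    have h := hmono.inner_sub_nonneg_of_frequently
      (mem_nhdsSet_iff_forall.1 hU _ (smul_sub_smul_mem_backHull i)) (hfreq i)
      ⟨subset_of_mem_nhdsSet hU (interior_subset hy), hyD⟩
    rwa [inner_sub_right, sub_nonneg] at h
  have hhull := convexHull_min hvertices
    (convex_halfSpace_le (innerₛₗ ℝ (T y - t • q)).isLinear _)
  rw [← backHull_eq_convexHull] at hhull
  have hzero : -(T y - t • q) = 0 := eq_zero_of_forall_inner_nonneg hy fun x hx => by
    rw [inner_neg_left, inner_sub_right, neg_sub, sub_nonneg]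
    exact hhull hx
  rwa [neg_eq_zero, sub_eq_zero] at hzero

theorem not_isMonotoneMapOn_of_frequently (ht : t ≠ 0) (hspan : affineSpan ℝ (range v) = ⊤)
    (hD : volume (backHull v q t \ D) = 0)
    (hfreq : ∀ i, ∃ᶠ x in 𝓝 (t • q), x - t • v i ∈ D ∧ T (x - t • v i) = x)
    (hfiber : volume (T ⁻¹' {t • q} ∩ D) = 0) (hU : U ∈ 𝓝ˢ (backHull v q t)) :
    ¬ IsMonotoneMapOn D T U := fun hmono => by
  have hcover : interior (backHull v q t) ⊆ T ⁻¹' {t • q} ∩ D ∪ backHull v q t \ D := fun y hy => by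
    by_cases hyD : y ∈ D
    · exact .inl ⟨hmono.eq_smul_of_mem_interior_backHull hU hfreq hy hyD, hyD⟩
    · exact .inr ⟨interior_subset hy, hyD⟩
  exact (isOpen_interior.measure_pos volume (interior_backHull_nonempty ht hspan)).ne'
    (measure_mono_null hcover (measure_union_null hfiber hD))

theorem IsConvexGradientOn.exists_isMonotoneMapOn (h : IsConvexGradientOn D T U) :
    ∃ A, volume A = 0 ∧ IsMonotoneMapOn (D \ A) T U := by
  obtain ⟨ψ, hψ, hae⟩ := h
  refine ⟨_, hae, fun y hy y' hy' => ?_⟩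
  exact inner_sub_nonneg_of_convexOn_of_hasGradientAt hψ hy.1 hy'.1
    (not_not.1 hy.2.2 hy.1 hy.2.1) (not_not.1 hy'.2.2 hy'.1 hy'.2.1)

variable [Fintype ι] [Nonempty ι]

theorem adhesionFlow_sub_smul_of_mem_openSector {r : ℝ} (hq : ∀ i, dist (v i) q = r) (ht : 0 ≤ t)
    {i : ι} {x : Plane} (hx : x ∈ openSector v q t i) :
    adhesionFlow (minInner v) t (x - t • v i) = x := by
  have h := adhesionFlow_eq_add_smul v ht (y := x - t • v i) (i := i)
  rw [sub_add_cancel] at h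
  exact h (inviscidPotential_eq_of_le v (inner_sub_le_of_mem_openSector hq hx))

theorem frequently_mem_diff_and_eq {r : ℝ} (hq : ∀ i, dist (v i) q = r) (ht : 0 ≤ t)
    {N : Set Plane} (hN : N ∈ 𝓝 (t • q))
    (hcorrect : ∀ᵐ x, x ∈ N → ∀ y, adhesionFlow (minInner v) t y = x → y ∈ D ∧ T y = x)
    {A : Set Plane} (hA : volume A = 0) (i : ι) :
    ∃ᶠ x in 𝓝 (t • q), x - t • v i ∈ D \ A ∧ T (x - t • v i) = x := by
  have hnotMem : ∀ᵐ x : Plane, x - t • v i ∉ A :=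
    (measurePreserving_sub_right volume (t • v i)).quasiMeasurePreserving.ae
      (measure_eq_zero_iff_ae_notMem.1 hA)
  have hclosure := closure_minimal
    ((Measure.dense_of_ae (hcorrect.and hnotMem)).open_subset_closure_inter (isOpen_openSector i))
    isClosed_closure (smul_mem_closure_openSector (t := t) hq i)
  refine ((mem_closure_iff_frequently.1 hclosure).and_eventually hN).mono ?_
  rintro x ⟨⟨hx, hxcorrect, hxA⟩, hxN⟩
  have hxD := hxcorrect hxN _ (adhesionFlow_sub_smul_of_mem_openSector hq ht hx)
  exact ⟨⟨hxD.1, hxA⟩, hxD.2⟩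

theorem adhesionMass_singleton_eq_zero (ht : 0 < t) (hq : q ∉ convexHull ℝ (range v)) :
    adhesionMass (minInner v) t {t • q} = 0 := by
  rw [adhesionMass, Measure.map_apply (continuous_adhesionFlow v ht.le).measurable
    (measurableSet_singleton _)]
  exact volume_adhesionFlow_eq_smul v hq ht

theorem not_isMonotoneMapOn_diff_of_ae_correct {r : ℝ} (hq : ∀ i, dist (v i) q = r)
    (hspan : affineSpan ℝ (range v) = ⊤) (hqv : q ∉ convexHull ℝ (range v)) (ht : 0 < t)
    (hD : volume (backHull v q t \ D) = 0) (hT : AEMeasurable T (volume.restrict D))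
    {N : Set Plane} (hN : N ∈ 𝓝 (t • q))
    (hpush : Measure.map T (volume.restrict D) {t • q} = adhesionMass (minInner v) t {t • q})
    (hcorrect : ∀ᵐ x, x ∈ N → ∀ y, adhesionFlow (minInner v) t y = x → y ∈ D ∧ T y = x)
    {A : Set Plane} (hA : volume A = 0) (hU : U ∈ 𝓝ˢ (backHull v q t)) :
    ¬ IsMonotoneMapOn (D \ A) T U := by
  refine not_isMonotoneMapOn_of_frequently ht.ne' hspan ?_
    (frequently_mem_diff_and_eq hq ht.le hN hcorrect hA) ?_ hU
  · rw [sdiff_sdiff_right]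
    exact measure_union_null hD (measure_mono_null inter_subset_right hA)
  · rw [adhesionMass_singleton_eq_zero ht hqv,
      Measure.map_apply_of_aemeasurable hT (measurableSet_singleton _)] at hpush
    exact measure_mono_null (inter_subset_inter_right _ sdiff_subset)
      (le_antisymm (hpush ▸ Measure.le_restrict_apply _ _) zero_le)

end Reconstruction

end

theorem mainTheorem4_general {ι : Type*} [Fintype ι] [Nonempty ι] {v : ι → Plane} {q : Plane}
    {r : ℝ} (hq : ∀ i, dist (v i) q = r) (hspan : affineSpan ℝ (Set.range v) = ⊤)
    (hqv : q ∉ convexHull ℝ (Set.range v)) {t : ℝ} (ht : 0 < t)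
    {D : Set Plane} (hD : volume (backHull v q t \ D) = 0)
    {T : Plane → Plane} (hT : AEMeasurable T (volume.restrict D))
    {N : Set Plane} (hN : N ∈ 𝓝 (t • q))
    (hpush : Measure.map T (volume.restrict D) {t • q} = adhesionMass (minInner v) t {t • q})
    (hcorrect : ∀ᵐ x, x ∈ N → ∀ y, adhesionFlow (minInner v) t y = x → y ∈ D ∧ T y = x) :
    (∀ U ∈ 𝓝ˢ (backHull v q t), ¬ IsMonotoneMapOn D T U) ∧
    (∀ U ∈ 𝓝ˢ (backHull v q t), ¬ IsConvexGradientOn D T U) := by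
  have hmonotone := fun {A : Set Plane} (hA : volume A = 0) {U} =>
    not_isMonotoneMapOn_diff_of_ae_correct (U := U) hq hspan hqv ht hD hT hN hpush hcorrect hA
  refine ⟨fun U hU => ?_, fun U hU hgradient => ?_⟩
  · simpa using hmonotone measure_empty hU
  · obtain ⟨A, hA, hmono⟩ := hgradient.exists_isMonotoneMapOn
    exact hmonotone hA hU hmono

theorem mainTheorem4
    (Δ : Affine.Triangle ℝ Plane)
    (hΔ : Δ.circumcenter ∉ convexHull ℝ (Set.range Δ.points))
    (t : ℝ) (ht : 0 < t)
    -- `T` is a map with domain of definition `D`, containing almost every point of `Ω`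
    (Ω : Set Plane) (hΩ : IsOpen Ω) (hsub : backTriangle Δ t ⊆ Ω)
    (D : Set Plane) (hD : volume (Ω \ D) = 0)
    (T : Plane → Plane) (hT : AEMeasurable T (volume.restrict D))
    (N : Set Plane) (hN : N ∈ 𝓝 (t • Δ.circumcenter))
    -- push-forward property for Borel sets in the neighborhood `N` of the triple point
    (hpush : ∀ B ⊆ N, MeasurableSet B →
      Measure.map T (volume.restrict D) B = adhesionMass (threeSectorPotential Δ) t B)
    -- correct reconstruction at almost every `x` in `N`
    (hcorrect : ∀ᵐ x : Plane, x ∈ N →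
      {y | y ∈ D ∧ T y = x} = {y | adhesionFlow (threeSectorPotential Δ) t y = x}) :
    (∀ U ∈ 𝓝ˢ (backTriangle Δ t), ¬ IsMonotoneMapOn D T U) ∧
    (∀ U ∈ 𝓝ˢ (backTriangle Δ t), ¬ IsConvexGradientOn D T U) :=
  mainTheorem4_general Δ.dist_circumcenter_eq_circumradius
    (Δ.independent.affineSpan_eq_top_iff_card_eq_finrank_add_one.2 (by simp)) hΔ ht
    (measure_mono_null (Set.sdiff_subset_sdiff_left hsub) hD) hT hN
    (hpush _ (Set.singleton_subset_iff.2 (mem_of_mem_nhds hN)) (measurableSet_singleton _))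
    (hcorrect.mono fun _ hx hxN _ hy => (hx hxN).ge hy)
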